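/- Let $k=\mathbb F_q$ be a finite field, $d\ge 1$, $R=k[[T^2,T^3]]$, $\mathfrak m=(T^2,T^3)\subset R$ and $F=R^d=Ru_1\oplus\cdots\oplus Ru_d$. Let $\mathrm{Hilb}_{d,n}$ be the set of $R$-submodules of $\mathfrak mF$ of $k$-codimension $n$ in $\mathfrak mF$, and put $H_d(t)=\sum_{n\ge 0}|\mathrm{Hilb}_{d,n}|\,t^n$. **Leading term data.** Order the monomials $T^nu_i$ of $F$ first by $n$, then by $i$; the leading term of $f\in F\setminus\{0\}$ is its term with the smallest monomial, $\mathrm{LT}(0)=0$, and $\mathrm{LT}(N)$ is the submodule generated by the leading terms of the elements of $N$. The nonzero proper monomial ideals of $R$ are $J(a)=(T^{a+1})$ for $a\ge 1$ and $K(a)=(T^{a+2},T^{a+3})$ for $a\ge 0$. We say that $J(a)$ has color $J$ and level $a-1$, and that $K(a)$ has color $K$ and level $a$. Let $\Xi$ be the set of $d$-tuples $\alpha=(I_1,\dots,I_d)$ of such ideals, $M_\alpha=I_1u_1\oplus\cdots\oplus I_du_d$, $n(\alpha)=\dim_k\mathfrak mF/M_\alpha$, let $\mathrm{Hilb}(\alpha)$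 be the set of submodules $N\subseteq\mathfrak mF$ with $\mathrm{LT}(N)=M_\alpha$, and $\mathrm{Cont}(\alpha)=|\mathrm{Hilb}(\alpha)|\,t^{n(\alpha)}$. For $x=(x_1,\dots,x_d)\in\mathbb N^d$, sort the seats $1,\dots,d$ by $x_i$, ties being broken by $i$, into $i_{(1)},\dots,i_{(d)}$. An element $\alpha\in\Xi$ is the same as its level vector $l(\alpha)\in\mathbb N^d$ (arranged by seats) together with its color vector $c(\alpha)\in\{J,K\}^d$, whose $j$-th entry is the color of the component in seat $i_{(j)}$ (sorted by $l(\alpha)$). For $b<h$ put $\delta_{bh}(x)=\lfloor x_{i_{(h)}}+i_{(h)}/d-x_{i_{(b)}}-i_{(b)}/d\rfloor$, and $\delta_{bh}(\alpha)=\delta_{bh}(l(\alpha))$. **Spiral raising.** For $1\le j\le d$ let $a_1<\dots<a_{d-j+1}$ be the elements of $\{i_{(j)},\dots,i_{(d)}\}$. The operator $\gamma_{(j)}$ on $\mathbb N^d$ is $\gamma_{(j)}(x)_{a_{r+1}}=x_{a_r}$ for $1\le r\le d-j$, $\gamma_{(j)}(x)_{a_1}=x_{a_{d-j+1}}+1$,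 and $\gamma_{(j)}(x)_i=x_i$ for the other $i$. It acts on $\Xi$ through the level vector, leaving the color vector unchanged. For $a\in\Gamma:=\mathbb N^d$ put $a\cdot\alpha=\gamma_{(1)}^{a_1}\circ\cdots\circ\gamma_{(d)}^{a_d}(\alpha)$. We call $\alpha$ stable under $\gamma_{(j)}$ if for all $1\le b<j\le h\le d$: $\delta_{bh}(\alpha)\ge 1$ whenever $c(\alpha)_b=J$, and $\delta_{bh}(\alpha)\ge 3$ whenever $c(\alpha)_b=c(\alpha)_h=K$. **Theorem.** Let $\mathbf 0_c\in\Xi$ have level vector $0$ and color vector $c$. Let $B=\{(0,b_2,\dots,b_d): 0\le b_j\le 3(d-j+1)\text{ for }2\le j\le d\}$. For $b\in B$ let $G_b=\{1\}\cup\{j\geq 2: b_j=3(d-j+1)\}$, and let $\Gamma_b$ be the subsemigroup with identity of $\Gamma$ generated by the unit vectors $e_j$, $j\in G_b$ (so $e_j$ acts as $\gamma_{(j)}$). Then: 1. All the sets $\mathrm{Hilb}_{d,n}$ and $\mathrm{Hilb}(\alpha)$ are finite. 2. For all $c\in\{J,K\}^d$ and $b\in B$, the element $b\cdot\mathbf 0_c$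 is stable under $\gamma_{(j)}$ for every $j\in G_b$, and $$\Xi=\bigsqcup_{c\in\{J,K\}^d}\ \bigsqcup_{b\in B}\Gamma_b\,(b\cdot\mathbf 0_c)$$ (a disjoint union). 3. As power series in $t$, $$H_d(t)=\sum_{c\in\{J,K\}^d}\sum_{b\in B}\frac{\mathrm{Cont}(b\cdot\mathbf 0_c)}{\prod_{j\in G_b}(1-q^{j-1}t)}=\sum_{c\in\{J,K\}^d}\sum_{b\in B}\frac{|\mathrm{Hilb}(b\cdot\mathbf 0_c)|}{\prod_{j\in G_b}(1-q^{j-1}t)}\,t^{\,b_2+\cdots+b_d+\#_J(c)},$$ where $\#_J(c)$ is the number of $J$'s in $c$. 4. The product $(1-t)(1-qt)\cdots(1-q^{d-1}t)\,H_d(t)$ is a polynomial in $t$ with integer coefficients. -/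

import Mathlib

namespace CuspQuot

noncomputable section

/-! ### The ring `R = k[[T^2,T^3]]` and the module `𝔪F`, `F = R^d` -/

/-- The subalgebra `k[[T^2,T^3]]` of `k[[T]]`: the power series without term in degree `1`. -/
def cuspSubalgebra (k : Type*) [Field k] : Subalgebra k (PowerSeries k) where
  carrier := {f | PowerSeries.coeff 1 f = 0}
  mul_mem' := by
    intro f g hf hg
    change PowerSeries.coeff 1 (f * g) = 0
    change PowerSeries.coeff 1 f = 0 at hf
    change PowerSeries.coeff 1 g = 0 at hg
    rw [PowerSeries.coeff_one_mul, hf, hg, zero_mul, zero_mul, add_zero]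
  add_mem' := by
    intro f g hf hg
    change PowerSeries.coeff 1 (f + g) = 0
    change PowerSeries.coeff 1 f = 0 at hf
    change PowerSeries.coeff 1 g = 0 at hg
    rw [map_add, hf, hg, add_zero]
  algebraMap_mem' := by
    intro r
    change PowerSeries.coeff 1 (PowerSeries.C r) = 0
    simp

/-- The ring `R = k[[T^2,T^3]]`. -/
def Cusp (k : Type*) [Field k] : Type _ := cuspSubalgebra k

instance (k : Type*) [Field k] : CommRing (Cusp k) := inferInstanceAs (CommRing (cuspSubalgebra k))

instance (k : Type*) [Field k] : Algebra k (Cusp k) :=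
  inferInstanceAs (Algebra k (cuspSubalgebra k))

/-- The inclusion of `R` in `k[[T]]`. -/
def Cusp.val {k : Type*} [Field k] : Cusp k →ₐ[k] PowerSeries k := (cuspSubalgebra k).val

/-- The element of `R` given by a power series without term in degree `1`. -/
def Cusp.mk {k : Type*} [Field k] (f : PowerSeries k) (hf : PowerSeries.coeff 1 f = 0) : Cusp k :=
  (⟨f, hf⟩ : cuspSubalgebra k)

theorem Cusp.coeff_one_val {k : Type*} [Field k] (f : Cusp k) :
    PowerSeries.coeff 1 f.val = 0 :=
  Subtype.property (p := fun g => g ∈ cuspSubalgebra k) f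

/-- The monomial `T^(l+2)` of `k[[T^2,T^3]]`. -/
def tPow (k : Type*) [Field k] (l : ℕ) : Cusp k :=
  Cusp.mk (PowerSeries.X ^ (l + 2)) (by rw [PowerSeries.coeff_X_pow, if_neg (by omega)])

/-- The maximal ideal `𝔪 = (T^2,T^3)` of `R`. -/
def maxIdeal (k : Type*) [Field k] : Ideal (Cusp k) := Ideal.span {tPow k 0, tPow k 1}

/-- The free module `F = R u_1 ⊕ ⋯ ⊕ R u_d`. -/
abbrev Free (k : Type*) [Field k] (d : ℕ) : Type _ := Fin d → Cusp k

/-- The submodule `𝔪F` of `F`. -/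
def mF (k : Type*) [Field k] (d : ℕ) : Submodule (Cusp k) (Free k d) :=
  maxIdeal k • (⊤ : Submodule (Cusp k) (Free k d))

/-- The quotient `𝔪F / N` (for `N ⊆ 𝔪F`). -/
abbrev QuotMF {k : Type*} [Field k] {d : ℕ} (N : Submodule (Cusp k) (Free k d)) : Type _ :=
  mF k d ⧸ N.submoduleOf (mF k d)

/-- The set of `R`-submodules of `𝔪F` of `k`-codimension `n` in `𝔪F`. -/
def HilbN (k : Type*) [Field k] (d n : ℕ) : Set (Submodule (Cusp k) (Free k d)) :=
  {N | N ≤ mF k d ∧ Module.Finite k (QuotMF N) ∧ Module.finrank k (QuotMF N) = n}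

/-- The series `H_d(t) = ∑ₙ |Hilb_{d,n}(R)| tⁿ`. -/
def H (k : Type*) [Field k] (d : ℕ) : PowerSeries ℚ :=
  PowerSeries.mk fun n => ((HilbN k d n).ncard : ℚ)

/-! ### Leading terms

The monomials of `F` are the `T^n u_i`; they are ordered first by `n`, then by `i`. -/

/-- `T^n u_i` is the leading (i.e. foremost) monomial of `f`. -/
def IsLeadingMonomial {k : Type*} [Field k] {d : ℕ} (f : Free k d) (n : ℕ) (i : Fin d) : Prop :=
  PowerSeries.coeff n (f i).val ≠ 0 ∧
    ∀ (m : ℕ) (j : Fin d), PowerSeries.coeff m (f j).val ≠ 0 →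
      n < m ∨ (n = m ∧ i ≤ j)

open Classical in
/-- The leading term of `f`, obtained from `f` by deleting all other terms; `LT(0) = 0`. -/
def leadingTerm {k : Type*} [Field k] {d : ℕ} (f : Free k d) : Free k d := fun i =>
  Cusp.mk
    (PowerSeries.mk fun n => if IsLeadingMonomial f n i then PowerSeries.coeff n (f i).val else 0)
    (by rw [PowerSeries.coeff_mk, Cusp.coeff_one_val, ite_self])

/-- The leading submodule `LT(N)`, generated by the leading terms of the elements of `N`. -/
def leadingSubmodule {k : Type*} [Field k] {d : ℕ} (N : Submodule (Cusp k) (Free k d)) :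
    Submodule (Cusp k) (Free k d) :=
  Submodule.span (Cusp k) (leadingTerm '' (N : Set (Free k d)))

/-! ### Leading term data -/

/-- The two colors. -/
inductive Color
  | J
  | K
  deriving DecidableEq

instance : Fintype Color := ⟨{Color.J, Color.K}, fun c => by cases c <;> decide⟩

/-- A nonzero proper monomial ideal of `R`, recorded by its color and its level:
color `J` and level `l` stand for `J(l+1) = (T^(l+2))`,
color `K` and level `l` stand for `K(l) = (T^(l+2), T^(l+3))`. -/
@[ext]
structure MonIdeal where
  color : Color
  level : ℕ

/-- The ideal of `R` recorded by an element of `MonIdeal`. -/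
def MonIdeal.toIdeal (k : Type*) [Field k] : MonIdeal → Ideal (Cusp k)
  | ⟨Color.J, l⟩ => Ideal.span {tPow k l}
  | ⟨Color.K, l⟩ => Ideal.span {tPow k l, tPow k (l + 1)}

/-- The set `Ξ` of leading term data `α = (I_1,…,I_d)`. -/
abbrev Datum (d : ℕ) : Type := Fin d → MonIdeal

/-- The monomial submodule `M_α = I_1 u_1 ⊕ ⋯ ⊕ I_d u_d`. -/
def monSubmodule (k : Type*) [Field k] {d : ℕ} (α : Datum d) :
    Submodule (Cusp k) (Free k d) :=
  Submodule.pi Set.univ fun i => (α i).toIdeal k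

/-- `n(α) = dim_k 𝔪F / M_α`. -/
def codim (k : Type*) [Field k] {d : ℕ} (α : Datum d) : ℕ :=
  Module.finrank k (QuotMF (monSubmodule k α))

/-- The Gröbner stratum `Hilb(α)`: the submodules of `𝔪F` with leading submodule `M_α`. -/
def Hilb (k : Type*) [Field k] {d : ℕ} (α : Datum d) : Set (Submodule (Cusp k) (Free k d)) :=
  {N | N ≤ mF k d ∧ leadingSubmodule N = monSubmodule k α}

/-- The content `Cont(α) = |Hilb(α)| t^n(α)`. -/
def content (k : Type*) [Field k] {d : ℕ} (α : Datum d) : PowerSeries ℚ :=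
  PowerSeries.C ((Hilb k α).ncard : ℚ) * PowerSeries.X ^ codim k α

end

/-! ### Levels, colors and spiral raising

Seats and ranks are elements of `Fin d`, so they are numbered from `0`: the operator `γ_(j)` with
`1 ≤ j ≤ d` is indexed here by `j - 1`. -/

/-- The seat of the component of rank `j` of `x`: components are sorted by level, then by seat. -/
def seat {d : ℕ} (x : Fin d → ℕ) (j : Fin d) : Fin d := Tuple.sort x j

/-- The level vector (arranged in seats). -/
def levelVec {d : ℕ} (α : Datum d) : Fin d → ℕ := fun i => (α i).level

/-- The color vector (arranged in ranks). -/
def colorVec {d : ℕ} (α : Datum d) : Fin d → Color := fun h => (α (seat (levelVec α) h)).color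

/-- A leading term datum is the same as a level vector with a color vector. -/
def levelColorEquiv (d : ℕ) : Datum d ≃ (Fin d → ℕ) × (Fin d → Color) where
  toFun α := (levelVec α, colorVec α)
  invFun p := fun i => ⟨p.2 ((Tuple.sort p.1).symm i), p.1 i⟩
  left_inv α := by
    funext i
    ext <;> simp [levelVec, colorVec, seat]
  right_inv p := by
    obtain ⟨x, c⟩ := p
    refine Prod.ext rfl ?_
    funext h
    exact congrArg c ((Tuple.sort x).symm_apply_apply h)

/-- The available seats `{i_(j),…,i_(d)}` of `γ_(j)`. -/
def availableSeats {d : ℕ} (j : Fin d) (x : Fin d → ℕ) : Finset (Fin d) :=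
  (Finset.Ici j).image (seat x)

theorem availableSeats_nonempty {d : ℕ} (j : Fin d) (x : Fin d → ℕ) :
    (availableSeats j x).Nonempty :=
  Finset.Nonempty.image ⟨j, Finset.mem_Ici.mpr le_rfl⟩ _

/-- The spiral raising operator on level vectors: an available seat receives the level of the
previous available seat; the leftmost available seat receives the level of the rightmost one,
raised by `1`; the other components are fixed. -/
def spiral {d : ℕ} (j : Fin d) (x : Fin d → ℕ) : Fin d → ℕ := fun a =>
  if a ∈ availableSeats j x then
    if h : ((availableSeats j x).filter (· < a)).Nonempty then
      x (((availableSeats j x).filter (· < a)).max' h)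
    else x ((availableSeats j x).max' (availableSeats_nonempty j x)) + 1
  else x a

/-- The spiral raising operator on `Ξ`: it acts on the level vector and keeps the color vector. -/
def gamma {d : ℕ} (j : Fin d) (α : Datum d) : Datum d :=
  (levelColorEquiv d).symm (spiral j (levelVec α), colorVec α)

/-- The action `a · α = γ_(1)^{a_1} ∘ ⋯ ∘ γ_(d)^{a_d} (α)` of `a ∈ Γ = ℕ^d` on `Ξ`. -/
def act {d : ℕ} (a : Fin d → ℕ) : Datum d → Datum d :=
  (List.finRange d).foldr (fun j f => (gamma j)^[a j] ∘ f) id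

/-- The datum `𝟎_c` with level vector `0` and color vector `c`. -/
def zeroDatum {d : ℕ} (c : Fin d → Color) : Datum d := (levelColorEquiv d).symm (0, c)

/-- The distance `δ_(bh)(x) = ⌊l_j + j/d - l_i - i/d⌋`, where `i`, `j` are the seats of the
components of rank `b`, `h`. -/
def dist {d : ℕ} (x : Fin d → ℕ) (b h : Fin d) : ℤ :=
  ⌊((x (seat x h) : ℚ) + ((seat x h : ℕ) : ℚ) / d)
    - ((x (seat x b) : ℚ) + ((seat x b : ℕ) : ℚ) / d)⌋

/-- `α` is stable under `γ_(j)`. -/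
def IsStable {d : ℕ} (j : Fin d) (α : Datum d) : Prop :=
  ∀ b h : Fin d, b < j → j ≤ h →
    (colorVec α b = Color.J → 1 ≤ dist (levelVec α) b h) ∧
    (colorVec α b = Color.K → colorVec α h = Color.K → 3 ≤ dist (levelVec α) b h)

/-- The rectangle `B`: `b_1 = 0` and `0 ≤ b_j ≤ 3(d-j+1)` for `2 ≤ j ≤ d`. -/
def rectangle (d : ℕ) : Finset (Fin d → ℕ) :=
  Fintype.piFinset fun j => if (j : ℕ) = 0 then {0} else Finset.range (3 * (d - (j : ℕ)) + 1)

/-- The indices of the generators of `Γ_b`: `γ_(1)`, and the `γ_(j)` with `b_j = 3(d-j+1)`. -/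
def generators {d : ℕ} (b : Fin d → ℕ) : Finset (Fin d) :=
  Finset.univ.filter fun j => (j : ℕ) = 0 ∨ b j = 3 * (d - (j : ℕ))

/-- The subsemigroup (with identity) `Γ_b` of `Γ = ℕ^d`. -/
def GammaB {d : ℕ} (b : Fin d → ℕ) : AddSubmonoid (Fin d → ℕ) :=
  AddSubmonoid.closure ((fun j => Pi.single j 1) '' (generators b : Set (Fin d)))

/-- The orbit `Γ_b (b · 𝟎_c)`. -/
def orbit {d : ℕ} (c : Fin d → Color) (b : Fin d → ℕ) : Set (Datum d) :=
  (fun a => act a (act b (zeroDatum c))) '' (GammaB b : Set (Fin d → ℕ))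

/-- The number of `J`'s in a color vector. -/
def numJ {d : ℕ} (c : Fin d → Color) : ℕ := (Finset.univ.filter fun h => c h = Color.J).card

end CuspQuot

/-! Send the monomial `T^(l+2) u_i` to the position `d * l + i`. Elements of `𝔪F` become sequences,
the monomial order becomes the order of `ℕ`, and multiplication by `T^2`, `T^3` becomes the shift by
`2d`, `3d`. The leading submodule of `N` is recorded by the set of orders of its elements
(`leadingSubmodule_eq_iff`), so `Hilb(α)` corresponds to the shift-closed subspaces that contain a
tail and have `orderSet α` as set of orders (`bijOn_seqSub`).

In this picture `γ_(j)` is a slide. The residue classes mod `d` of the components of rank below `j`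
are blocked; every other position is free and moves to the next free position (`rankKey_spiral`,
`orderSet_gamma`). A slide misses exactly one position, so the codimension grows by `1`.

The heart is `Separated.bijOn`. Suppose that the first order `E i` in each blocked class lies more
than `3d` before the orders in free classes. Then each subspace with the slid orders arises in
exactly one way by sliding the free coordinates of a subspace with the old orders and moving the
result by a unipotent map `unip v`, with one parameter for each of the `j-1` blocked classes. This
is the factor `q^(j-1)`. The parameter `v` is found by normalization: a slid subspace has no term at
the free position next to `E i`, a triangular system has one solution `v` that achieves this, and
the normalization then spreads to all blocked orders. The hard order is `E i + d`, because `T` is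
not in `R`.

The rest is combinatorics. Colors together with the coordinates `coord` identify `Ξ` with `{J,K}^d ×
ℕ^d`, and `γ_(j)` adds a unit vector (`coord_spiral`). By pigeonhole, a coordinate that reaches
`3(d-j+1)` forces separation (`rankKey_add_lt`), hence stability. Truncating coordinates at these
thresholds cuts `ℕ^d` into translates `b + Γ_b`, on which the contents form products of geometric
series. -/

namespace CuspQuot

noncomputable section

/-! ### Subspaces of sequences and their sets of orders -/

section Sequences

variable {k : Type*} [Field k]

/-- The shift of sequences by `s` places to the right. -/
def shift (s : ℕ) : (ℕ → k) →ₗ[k] (ℕ → k) where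
  toFun f n := if s ≤ n then f (n - s) else 0
  map_add' f g := by funext n; by_cases h : s ≤ n <;> simp [h]
  map_smul' c f := by funext n; by_cases h : s ≤ n <;> simp [h]

theorem shift_apply (s : ℕ) (f : ℕ → k) (n : ℕ) :
    shift s f n = if s ≤ n then f (n - s) else 0 := rfl

@[simp]
theorem shift_add_apply (s : ℕ) (f : ℕ → k) (n : ℕ) : shift s f (n + s) = f n := by
  simp [shift_apply]

theorem shift_shift (s t : ℕ) (f : ℕ → k) : shift s (shift t f) = shift (s + t) f := by
  funext n
  simp only [shift_apply]
  split_ifs <;> first | omega | rfl | (congr 1; omega)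

/-- The sequence `f` has order `n`. -/
def HasOrder (f : ℕ → k) (n : ℕ) : Prop := f n ≠ 0 ∧ ∀ m < n, f m = 0

theorem exists_hasOrder {f : ℕ → k} {t : ℕ} (h : f t ≠ 0) : ∃ n ≤ t, HasOrder f n := by
  classical
  have hex : ∃ n, f n ≠ 0 := ⟨t, h⟩
  exact ⟨Nat.find hex, Nat.find_min' hex h, Nat.find_spec hex,
    fun m hm => not_not.mp (Nat.find_min hex hm)⟩

theorem HasOrder.shift {f : ℕ → k} {n : ℕ} (h : HasOrder f n) (s : ℕ) :
    HasOrder (shift s f) (n + s) := by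
  refine ⟨by simpa using h.1, fun m hm => ?_⟩
  rw [shift_apply]
  split_ifs
  · exact h.2 _ (by omega)
  · rfl

/-- The set of orders of the nonzero elements of `N`. -/
def orders (N : Submodule k (ℕ → k)) : Set ℕ := {n | ∃ f ∈ N, HasOrder f n}

/-- The sequences that vanish before `M`. -/
def tail (k : Type*) [Field k] (M : ℕ) : Submodule k (ℕ → k) where
  carrier := {f | ∀ m < M, f m = 0}
  add_mem' := fun hf hg m hm => by rw [Pi.add_apply, hf m hm, hg m hm, add_zero]
  zero_mem' := fun _ _ => rfl
  smul_mem' := fun c f hf m hm => by rw [Pi.smul_apply, hf m hm, smul_zero]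

theorem tail_antitone : Antitone (tail k) := fun _ _ h _ hf m hm => hf m (hm.trans_le h)

/-- The sequences that vanish at `t`. -/
def vanishing (k : Type*) [Field k] (t : ℕ) : Submodule k (ℕ → k) :=
  LinearMap.ker (LinearMap.proj t : (ℕ → k) →ₗ[k] k)

theorem mem_vanishing {t : ℕ} {f : ℕ → k} : f ∈ vanishing k t ↔ f t = 0 := Iff.rfl

/-- Gaussian elimination from the left: correcting by an element of order `t` leaves all earlier
positions alone. Thus `f - g` is the remainder of `f` modulo `N` up to `t`. -/
theorem exists_mem_agree (N : Submodule k (ℕ → k)) (f : ℕ → k) (a : ℕ) (hf : ∀ m < a, f m = 0)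
    (t : ℕ) : ∃ g ∈ N, (∀ m < a, g m = 0) ∧ ∀ m ∈ orders N, m < t → f m = g m := by
  induction t with
  | zero => exact ⟨0, N.zero_mem, fun _ _ => rfl, fun m _ h => absurd h (Nat.not_lt_zero m)⟩
  | succ t ih =>
    obtain ⟨g, hg, hga, hgt⟩ := ih
    by_cases ht : t ∈ orders N ∧ a ≤ t
    · obtain ⟨⟨h, hN, h0, hlt⟩, hat⟩ := ht
      refine ⟨g + ((f t - g t) / h t) • h, N.add_mem hg (N.smul_mem _ hN), fun m hm => ?_,
        fun m hm hmt => ?_⟩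
      · simp [hga m hm, hlt m (hm.trans_le hat)]
      · rcases Nat.lt_succ_iff_lt_or_eq.mp hmt with hm' | rfl
        · simp [hgt m hm hm', hlt m hm']
        · simp [div_mul_cancel₀ _ h0]
    · refine ⟨g, hg, hga, fun m hm hmt => ?_⟩
      rcases Nat.lt_succ_iff_lt_or_eq.mp hmt with hm' | rfl
      · exact hgt m hm hm'
      · have : m < a := by
          by_contra hma
          exact ht ⟨hm, not_lt.mp hma⟩
        rw [hf m this, hga m this]

/-- Elimination of the terms of `f` before the position `t`. -/
theorem mem_orders_of_eliminate {N : Submodule k (ℕ → k)} {f : ℕ → k} {a t : ℕ} (hfN : f ∈ N)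
    (hf : ∀ m < a, f m = 0) (ht : f t ≠ 0)
    (h : ∀ m ∈ orders N, a ≤ m → m < t → m ∈ orders (N ⊓ vanishing k t)) : t ∈ orders N := by
  -- Eliminating only with elements that vanish at `t` keeps the coefficient of `f` there.
  obtain ⟨g, hg, hga, hgt⟩ := exists_mem_agree (N ⊓ vanishing k t) f a hf t
  have hfg : f - g ∈ N := N.sub_mem hfN hg.1
  have hgt0 : g t = 0 := hg.2
  obtain ⟨n, hnt, hn⟩ := exists_hasOrder (f := f - g) (t := t) (by simpa [hgt0] using ht)
  rcases hnt.lt_or_eq with hlt | rfl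
  · exfalso
    have hna : a ≤ n := by
      by_contra hna
      exact hn.1 (by simp [hf n (not_le.mp hna), hga n (not_le.mp hna)])
    exact hn.1 (by simp [hgt n (h n ⟨_, hfg, hn⟩ hna hlt) hlt])
  · exact ⟨_, hfg, hn⟩

theorem tail_le_of_subset_orders {N : Submodule k (ℕ → k)} {M M' : ℕ} (h : tail k M' ≤ N)
    (hM : Set.Ici M ⊆ orders N) : tail k M ≤ N := by
  intro f hf
  obtain ⟨g, hg, hgM, hfg⟩ := exists_mem_agree N f M hf M'
  have : f - g ∈ tail k M' := fun m hm => by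
    by_cases hmM : m < M
    · simp [hf m hmM, hgM m hmM]
    · simp [hfg m (hM (not_lt.mp hmM)) hm]
  simpa using N.add_mem (h this) hg

theorem Ici_subset_orders {N : Submodule k (ℕ → k)} {M : ℕ} (h : tail k M ≤ N) :
    Set.Ici M ⊆ orders N := by
  intro n hn
  refine ⟨Pi.single n 1, h fun m hm => ?_, by simp, fun m hm => ?_⟩
  · exact Pi.single_eq_of_ne (by simp at hn; omega) _
  · exact Pi.single_eq_of_ne hm.ne _

/-- The complement of a subspace containing a tail is spanned by the sequences that are
supported outside the set of orders. -/
theorem finite_and_finrank_quotient {N : Submodule k (ℕ → k)} {M : ℕ} (h : tail k M ≤ N) :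
    Module.Finite k ((ℕ → k) ⧸ N) ∧
      Module.finrank k ((ℕ → k) ⧸ N) = (orders N)ᶜ.ncard := by
  classical
  have hfin : ((orders N)ᶜ).Finite := (Set.finite_Iio M).subset fun n hn => by
    by_contra hM
    exact hn (Ici_subset_orders h (Set.mem_Ici.mpr (not_lt.mp hM)))
  have := hfin.to_subtype
  let ι : (↥(orders N)ᶜ → k) →ₗ[k] (ℕ → k) :=
    Function.ExtendByZero.linearMap k (Subtype.val : ↥(orders N)ᶜ → ℕ)
  have hι (f) (n : ↥(orders N)ᶜ) : ι f n = f n :=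
    Subtype.val_injective.extend_apply f (0 : ℕ → k) n
  have hι0 (f) (n : ℕ) (hn : n ∈ orders N) : ι f n = 0 :=
    Function.extend_apply' f (0 : ℕ → k) n fun ⟨m, hm⟩ => m.2 (hm ▸ hn)
  have hinj : Function.Injective (N.mkQ ∘ₗ ι) := by
    rw [injective_iff_map_eq_zero]
    intro f hf
    have hmem : ι f ∈ N := by simpa using hf
    by_contra hne
    obtain ⟨n, hn⟩ := Function.ne_iff.mp hne
    obtain ⟨m, -, hm⟩ := exists_hasOrder (f := ι f) (t := n) (by rw [hι]; exact hn)
    exact hm.1 (hι0 f m ⟨_, hmem, hm⟩)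
  have hsurj : Function.Surjective (N.mkQ ∘ₗ ι) := by
    intro y
    obtain ⟨f, rfl⟩ := N.mkQ_surjective y
    obtain ⟨g, hg, -, hfg⟩ := exists_mem_agree N f 0 (by simp) M
    refine ⟨fun n => f n - g n, ?_⟩
    rw [LinearMap.comp_apply, Submodule.mkQ_apply, Submodule.mkQ_apply, Submodule.Quotient.eq]
    have : ι (fun n => f n - g n) - f + g ∈ N := h fun m hm => by
      by_cases hmN : m ∈ orders N
      · simp [hι0 _ m hmN, hfg m hmN hm]
      · have := hι (fun n => f n - g n) ⟨m, hmN⟩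
        simp [this]
    simpa using N.sub_mem this hg
  let e := LinearEquiv.ofBijective (N.mkQ ∘ₗ ι) ⟨hinj, hsurj⟩
  refine ⟨Module.Finite.equiv e, ?_⟩
  have := Fintype.ofFinite ↥(orders N)ᶜ
  rw [← e.finrank_eq, Module.finrank_fintype_fun_eq_card, Set.ncard_eq_toFinset_card',
    Set.toFinset_card]

/-- The subspaces that are closed under the shifts by `2d` and `3d` and contain a tail, with
a given set of orders. -/
def stratum (k : Type*) [Field k] (d : ℕ) (Λ : Set ℕ) : Set (Submodule k (ℕ → k)) :=
  {N | (∀ f ∈ N, shift (2 * d) f ∈ N ∧ shift (3 * d) f ∈ N) ∧ (∃ M, tail k M ≤ N) ∧ orders N = Λ}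

/-- The numerical semigroup generated by `2` and `3` is `ℕ` without `1`. -/
theorem shift_mem {N : Submodule k (ℕ → k)} {d : ℕ}
    (h : ∀ f ∈ N, shift (2 * d) f ∈ N ∧ shift (3 * d) f ∈ N) {f : ℕ → k} (hf : f ∈ N) (r : ℕ)
    (hr : r ≠ 1) : shift (r * d) f ∈ N := by
  induction r using Nat.strong_induction_on generalizing f with
  | _ r ih =>
    match r, hr with
    | 0, _ =>
      have : shift (0 * d) f = f := by funext n; simp [shift_apply]
      rwa [this]
    | 2, _ => exact (h f hf).1
    | 3, _ => exact (h f hf).2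
    | r + 4, _ =>
      have := ih (r + 2) (by omega) (h f hf).1 (by omega)
      rw [shift_shift] at this
      convert this using 2
      ring_nf

/-- The set `Λ` alone determines a tail contained in every member, so the members are preimages of
subspaces of one finite quotient. -/
theorem finite_stratum [Finite k] (d : ℕ) (Λ : Set ℕ) : (stratum k d Λ).Finite := by
  rcases (stratum k d Λ).eq_empty_or_nonempty with he | ⟨N₀, -, ⟨M, hM⟩, rfl⟩
  · rw [he]; exact Set.finite_empty
  have := (finite_and_finrank_quotient (le_refl (tail k M))).1
  have : Finite ((ℕ → k) ⧸ tail k M) := Module.finite_of_finite k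
  refine (Set.finite_range (Submodule.comap (tail k M).mkQ)).subset ?_
  rintro N ⟨-, ⟨M', hM'⟩, hN⟩
  refine ⟨N.map (tail k M).mkQ, ?_⟩
  rw [Submodule.comap_map_mkQ, sup_eq_right]
  exact tail_le_of_subset_orders hM' (hN ▸ Ici_subset_orders hM)

end Sequences

/-! ### Sliding the free positions of a periodic pattern -/

section Pattern

/-- `P` is a `d`-periodic set of positions, and some position is free, i.e. not in `P`. -/
structure IsPattern (d : ℕ) (P : ℕ → Prop) : Prop where
  periodic : ∀ n, P (n + d) ↔ P n
  exists_free : ∃ n, ¬ P n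

/-- The next free position. -/
def nextFree (P : ℕ → Prop) (n : ℕ) : ℕ := sInf {m | n < m ∧ ¬ P m}

open Classical in
/-- Free positions slide to the next free position; the others are fixed. -/
def slide (P : ℕ → Prop) (n : ℕ) : ℕ := if P n then n else nextFree P n

variable {d : ℕ} {P : ℕ → Prop}

theorem IsPattern.periodic_mul (h : IsPattern d P) (n r : ℕ) : P (n + r * d) ↔ P n := by
  induction r with
  | zero => simp
  | succ r ih => rw [Nat.succ_mul, ← add_assoc, h.periodic, ih]

theorem IsPattern.mod_iff (h : IsPattern d P) (n : ℕ) : P (n % d) ↔ P n := by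
  conv_rhs => rw [← Nat.mod_add_div n d, mul_comm]
  exact (h.periodic_mul _ _).symm

variable [NeZero d]

theorem IsPattern.nextFree_spec (h : IsPattern d P) (n : ℕ) :
    n < nextFree P n ∧ ¬ P (nextFree P n) := by
  obtain ⟨m, hm⟩ := h.exists_free
  refine Nat.sInf_mem (s := {m | n < m ∧ ¬ P m}) ⟨m + (n + 1) * d, ?_, ?_⟩
  · have := NeZero.pos d
    nlinarith
  · rwa [h.periodic_mul]

theorem IsPattern.lt_nextFree (h : IsPattern d P) (n : ℕ) : n < nextFree P n :=
  (h.nextFree_spec n).1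

theorem IsPattern.not_nextFree (h : IsPattern d P) (n : ℕ) : ¬ P (nextFree P n) :=
  (h.nextFree_spec n).2

theorem nextFree_le {P : ℕ → Prop} {n m : ℕ} (hnm : n < m) (hm : ¬ P m) : nextFree P n ≤ m :=
  Nat.sInf_le ⟨hnm, hm⟩

theorem of_lt_nextFree {P : ℕ → Prop} {n m : ℕ} (hnm : n < m) (hm : m < nextFree P n) : P m := by
  by_contra hP
  exact absurd (nextFree_le hnm hP) (not_le.mpr hm)

theorem IsPattern.nextFree_eq (h : IsPattern d P) {n t : ℕ} (hnt : n < t) (ht : ¬ P t)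
    (hP : ∀ m, n < m → m < t → P m) : nextFree P n = t := by
  refine le_antisymm (nextFree_le hnt ht) ?_
  by_contra hlt
  exact h.not_nextFree n (hP _ (h.lt_nextFree n) (not_le.mp hlt))

theorem IsPattern.nextFree_eq_of_between (h : IsPattern d P) {n m : ℕ} (hnm : n < m)
    (hm : m < nextFree P n) : nextFree P m = nextFree P n :=
  h.nextFree_eq hm (h.not_nextFree n) fun _ hl hl' => of_lt_nextFree (hnm.trans hl) hl'

theorem IsPattern.nextFree_lt (h : IsPattern d P) {n m : ℕ} (hnm : n < m) (hm : ¬ P m) :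
    nextFree P n < nextFree P m :=
  (nextFree_le hnm hm).trans_lt (h.lt_nextFree m)

theorem IsPattern.nextFree_add (h : IsPattern d P) (n : ℕ) :
    nextFree P (n + d) = nextFree P n + d := by
  refine h.nextFree_eq (by have := h.lt_nextFree n; omega) ?_ fun m hm hm' => ?_
  · rw [h.periodic]; exact h.not_nextFree n
  · obtain ⟨l, rfl⟩ : ∃ l, m = l + d := ⟨m - d, by omega⟩
    rw [h.periodic]
    exact of_lt_nextFree (n := n) (by omega) (by omega)

theorem IsPattern.nextFree_add_mul (h : IsPattern d P) (n r : ℕ) :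
    nextFree P (n + r * d) = nextFree P n + r * d := by
  induction r with
  | zero => simp
  | succ r ih => rw [Nat.succ_mul, ← add_assoc, h.nextFree_add, ih, add_assoc]

/-- By periodicity the gap to the next free position is a function of the residue class. It serves
as the ordering in the triangular system for `v`. -/
theorem IsPattern.nextFree_sub (h : IsPattern d P) {n m : ℕ} (hnm : n % d = m % d) :
    nextFree P n - n = nextFree P m - m := by
  rw [← Nat.mod_add_div n d, ← Nat.mod_add_div m d, hnm, mul_comm d, mul_comm d,
    h.nextFree_add_mul, h.nextFree_add_mul]
  omega

theorem slide_of_mem {P : ℕ → Prop} {n : ℕ} (hn : P n) : slide P n = n := if_pos hn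

theorem slide_of_free {P : ℕ → Prop} {n : ℕ} (hn : ¬ P n) : slide P n = nextFree P n := if_neg hn

theorem IsPattern.le_slide (h : IsPattern d P) (n : ℕ) : n ≤ slide P n := by
  by_cases hn : P n
  · rw [slide_of_mem hn]
  · rw [slide_of_free hn]; exact (h.lt_nextFree n).le

theorem IsPattern.slide_mem_iff (h : IsPattern d P) (n : ℕ) : P (slide P n) ↔ P n := by
  by_cases hn : P n
  · rw [slide_of_mem hn]
  · rw [slide_of_free hn]; exact iff_of_false (h.not_nextFree n) hn

theorem IsPattern.slide_injective (h : IsPattern d P) : Function.Injective (slide P) := by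
  intro m n hmn
  have hP : P m ↔ P n := by rw [← h.slide_mem_iff, hmn, h.slide_mem_iff]
  by_cases hm : P m
  · rwa [slide_of_mem hm, slide_of_mem (hP.mp hm)] at hmn
  · have hn : ¬ P n := fun hn => hm (hP.mpr hn)
    rw [slide_of_free hm, slide_of_free hn] at hmn
    rcases lt_trichotomy m n with hlt | heq | hlt
    · exact absurd hmn (h.nextFree_lt hlt hn).ne
    · exact heq
    · exact absurd hmn (h.nextFree_lt hlt hm).ne'

theorem IsPattern.slide_add (h : IsPattern d P) (n : ℕ) : slide P (n + d) = slide P n + d := by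
  by_cases hn : P n
  · rw [slide_of_mem hn, slide_of_mem ((h.periodic n).mpr hn)]
  · rw [slide_of_free hn, slide_of_free (fun h' => hn ((h.periodic n).mp h')), h.nextFree_add]

theorem IsPattern.slide_add_mul (h : IsPattern d P) (n r : ℕ) :
    slide P (n + r * d) = slide P n + r * d := by
  induction r with
  | zero => simp
  | succ r ih => rw [Nat.succ_mul, ← add_assoc, h.slide_add, ih, add_assoc]

theorem IsPattern.not_mem_range_slide_iff (h : IsPattern d P) {t : ℕ} :
    t ∉ Set.range (slide P) ↔ ¬ P t ∧ ∀ m < t, P m := by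
  classical
  constructor
  · intro ht
    have hPt : ¬ P t := fun hPt => ht ⟨t, slide_of_mem hPt⟩
    refine ⟨hPt, fun m hm => ?_⟩
    by_contra hPm
    -- Counting down from `t - 1`, `Nat.find` yields the last free position before `t`; this one
    -- slides to `t`.
    have hex : ∃ j, j < t ∧ ¬ P (t - 1 - j) := ⟨t - 1 - m, by omega, by
      rwa [show t - 1 - (t - 1 - m) = m by omega]⟩
    obtain ⟨hj, hPj⟩ := Nat.find_spec hex
    refine ht ⟨t - 1 - Nat.find hex, ?_⟩
    rw [slide_of_free hPj]
    refine h.nextFree_eq (by omega) hPt fun l hl hl' => ?_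
    by_contra hPl
    exact Nat.find_min hex (m := t - 1 - l) (by omega) ⟨by omega, by
      rwa [show t - 1 - (t - 1 - l) = l by omega]⟩
  · rintro ⟨hPt, hlt⟩ ⟨n, rfl⟩
    rw [h.slide_mem_iff] at hPt
    refine hPt (hlt n ?_)
    rw [slide_of_free hPt]
    exact h.lt_nextFree n

/-- Only the first free position is vacated; this accounts for the increase of the codimension by
`1`. -/
theorem IsPattern.exists_compl_range_slide (h : IsPattern d P) :
    ∃ t, (Set.range (slide P))ᶜ = {t} := by
  classical
  refine ⟨Nat.find h.exists_free, Set.eq_singleton_iff_unique_mem.mpr ⟨?_, fun s hs => ?_⟩⟩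
  · rw [Set.mem_compl_iff, h.not_mem_range_slide_iff]
    exact ⟨Nat.find_spec h.exists_free, fun m hm => not_not.mp (Nat.find_min h.exists_free hm)⟩
  · rw [Set.mem_compl_iff, h.not_mem_range_slide_iff] at hs
    refine ((Nat.find_eq_iff _).mpr ⟨hs.1, fun m hm => ?_⟩).symm
    exact not_not.mpr (hs.2 m hm)

end Pattern

/-! ### Sliding subspaces -/

section Slide

variable {k : Type*} [Field k] {d : ℕ} [NeZero d] {P : ℕ → Prop}

/-- The sequence `g` with its free terms slid; the remaining free position gets `0`. -/
def slideSeq (k : Type*) [Field k] (P : ℕ → Prop) : (ℕ → k) →ₗ[k] (ℕ → k) :=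
  Function.ExtendByZero.linearMap k (slide P)

theorem IsPattern.slideSeq_slide (h : IsPattern d P) (g : ℕ → k) (n : ℕ) :
    slideSeq k P g (slide P n) = g n :=
  h.slide_injective.extend_apply g (0 : ℕ → k) n

theorem slideSeq_of_not_mem (g : ℕ → k) {t : ℕ} (ht : t ∉ Set.range (slide P)) :
    slideSeq k P g t = 0 :=
  Function.extend_apply' g (0 : ℕ → k) t ht

theorem IsPattern.slideSeq_of_mem (h : IsPattern d P) (g : ℕ → k) {n : ℕ} (hn : P n) :
    slideSeq k P g n = g n := by
  conv_lhs => rw [← slide_of_mem hn]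
  exact h.slideSeq_slide g n

theorem IsPattern.slideSeq_nextFree (h : IsPattern d P) (g : ℕ → k) {n : ℕ} (hn : ¬ P n) :
    slideSeq k P g (nextFree P n) = g n := by
  rw [← slide_of_free hn]
  exact h.slideSeq_slide g n

theorem IsPattern.slideSeq_injective (h : IsPattern d P) : Function.Injective (slideSeq k P) := by
  intro g g' hg
  funext n
  rw [← h.slideSeq_slide g n, hg, h.slideSeq_slide]

theorem IsPattern.slideSeq_eq_zero (h : IsPattern d P) {g : ℕ → k} {M : ℕ}
    (hg : ∀ m < M, g m = 0) {m : ℕ} (hm : m < M) : slideSeq k P g m = 0 := by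
  by_cases hr : m ∈ Set.range (slide P)
  · obtain ⟨l, rfl⟩ := hr
    rw [h.slideSeq_slide]
    exact hg l ((h.le_slide l).trans_lt hm)
  · exact slideSeq_of_not_mem g hr

/-- Free terms move strictly to the right, so at free positions the vanishing extends to `M` itself.
-/
theorem IsPattern.slideSeq_eq_zero_of_free (h : IsPattern d P) {g : ℕ → k} {M : ℕ}
    (hg : ∀ m < M, g m = 0) {m : ℕ} (hm : m ≤ M) (hP : ¬ P m) : slideSeq k P g m = 0 := by
  by_cases hr : m ∈ Set.range (slide P)
  · obtain ⟨l, rfl⟩ := hr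
    rw [h.slideSeq_slide]
    rw [h.slide_mem_iff] at hP
    rw [slide_of_free hP] at hm
    exact hg l ((h.lt_nextFree l).trans_le hm)
  · exact slideSeq_of_not_mem g hr

theorem IsPattern.slideSeq_comp_slide (h : IsPattern d P) {f : ℕ → k}
    (hf : ∀ t ∉ Set.range (slide P), f t = 0) : slideSeq k P (fun n => f (slide P n)) = f := by
  funext t
  by_cases ht : t ∈ Set.range (slide P)
  · obtain ⟨n, rfl⟩ := ht
    rw [h.slideSeq_slide]
  · rw [slideSeq_of_not_mem _ ht, hf t ht]

theorem IsPattern.slideSeq_shift (h : IsPattern d P) (g : ℕ → k) :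
    slideSeq k P (shift d g) = shift d (slideSeq k P g) := by
  funext t
  by_cases ht : t ∈ Set.range (slide P)
  · obtain ⟨n, rfl⟩ := ht
    rw [h.slideSeq_slide]
    by_cases hn : d ≤ n
    · obtain ⟨m, rfl⟩ : ∃ m, n = m + d := ⟨n - d, by omega⟩
      rw [h.slide_add, shift_add_apply, shift_add_apply, h.slideSeq_slide]
    · rw [shift_apply, if_neg hn, shift_apply]
      split_ifs with hs
      -- Here `n < d` slides beyond `d`. One period back lies the first free position, which
      -- receives `0`, so both sides vanish.
      · refine (slideSeq_of_not_mem g (h.not_mem_range_slide_iff.mpr ?_)).symm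
        have hP : ¬ P n := fun hP => by rw [slide_of_mem hP] at hs; omega
        rw [slide_of_free hP] at hs ⊢
        obtain ⟨l, hl⟩ : ∃ l, nextFree P n = l + d := ⟨nextFree P n - d, by omega⟩
        rw [hl, Nat.add_sub_cancel]
        refine ⟨?_, fun m hm => ?_⟩
        · rw [← h.periodic, ← hl]; exact h.not_nextFree n
        · rw [← h.periodic]; exact of_lt_nextFree (n := n) (by omega) (by omega)
      · rfl
  · rw [slideSeq_of_not_mem _ ht, shift_apply]
    split_ifs with hs
    · obtain ⟨l, rfl⟩ : ∃ l, t = l + d := ⟨t - d, by omega⟩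
      have hd := NeZero.pos d
      have := h.not_mem_range_slide_iff.mp ht
      exact absurd ((h.periodic l).mpr (this.2 l (by omega))) this.1
    · rfl

theorem IsPattern.slideSeq_shift_mul (h : IsPattern d P) (r : ℕ) (g : ℕ → k) :
    slideSeq k P (shift (r * d) g) = shift (r * d) (slideSeq k P g) := by
  induction r with
  | zero =>
    have (f : ℕ → k) : shift (0 * d) f = f := by funext n; simp [shift_apply]
    rw [this, this]
  | succ r ih =>
    rw [Nat.succ_mul, add_comm, ← shift_shift, h.slideSeq_shift, ih, shift_shift]

end Slide

/-! ### Unipotent transformations -/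

section Unipotent

variable {k : Type*} [Field k] {d : ℕ} [NeZero d] {P : ℕ → Prop}

open Classical in
/-- The periodic extension of `v` by zero. -/
def weight (d : ℕ) [NeZero d] {k : Type*} [Field k] {P : ℕ → Prop}
    (v : {i : Fin d // P i} → k) (n : ℕ) : k :=
  if h : P (Fin.ofNat d n : Fin d) then v ⟨Fin.ofNat d n, h⟩ else 0

theorem weight_add (v : {i : Fin d // P i} → k) (n : ℕ) : weight d v (n + d) = weight d v n := by
  have : Fin.ofNat d (n + d) = Fin.ofNat d n := Fin.ext (by simp)
  unfold weight
  rw [this]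

theorem weight_eq (v : {i : Fin d // P i} → k) {n : ℕ} (i : {i : Fin d // P i})
    (hn : n % d = i) : weight d v n = v i := by
  have : Fin.ofNat d n = i := Fin.ext (by simpa using hn)
  rw [weight, dif_pos (by rw [this]; exact i.2)]
  congr 1
  exact Subtype.ext this

theorem exists_of_weight_ne_zero {v : {i : Fin d // P i} → k} {n : ℕ} (h : weight d v n ≠ 0) :
    ∃ i : {i : Fin d // P i}, n % d = i := by
  rw [weight] at h
  split_ifs at h with hP
  · exact ⟨⟨_, hP⟩, by simp⟩
  · exact absurd rfl h

/-- The nilpotent transformation that maps the term at `n` in `P` to the next free position,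
with coefficient `v (n % d)`. -/
def nil (v : {i : Fin d // P i} → k) : (ℕ → k) →ₗ[k] (ℕ → k) where
  toFun f m := ∑ n ∈ (Finset.range m).filter (fun n => nextFree P n = m), weight d v n * f n
  map_add' f g := by funext m; simp [mul_add, Finset.sum_add_distrib]
  map_smul' c f := by funext m; simp [Finset.mul_sum, mul_left_comm]

theorem nil_apply (v : {i : Fin d // P i} → k) (f : ℕ → k) (m : ℕ) :
    nil v f m =
      ∑ n ∈ (Finset.range m).filter (fun n => nextFree P n = m), weight d v n * f n := rfl

theorem weight_add' (v w : {i : Fin d // P i} → k) (n : ℕ) :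
    weight d (v + w) n = weight d v n + weight d w n := by
  simp only [weight]; split_ifs <;> simp

theorem weight_smul (c : k) (v : {i : Fin d // P i} → k) (n : ℕ) :
    weight d (c • v) n = c * weight d v n := by
  simp only [weight]; split_ifs <;> simp

theorem nil_add (v w : {i : Fin d // P i} → k) (f : ℕ → k) :
    nil (v + w) f = nil v f + nil w f := by
  funext m
  simp [nil_apply, weight_add', add_mul, Finset.sum_add_distrib]

theorem nil_smul (c : k) (v : {i : Fin d // P i} → k) (f : ℕ → k) :
    nil (c • v) f = c • nil v f := by
  funext m
  simp [nil_apply, weight_smul, mul_assoc, Finset.mul_sum]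

/-- `nil w f` is supported on free positions, where every weight is zero. Hence `unip` turns
addition of parameters into composition. -/
theorem IsPattern.nil_nil (h : IsPattern d P) (v w : {i : Fin d // P i} → k) (f : ℕ → k) :
    nil v (nil w f) = 0 := by
  funext m
  rw [nil_apply]
  refine Finset.sum_eq_zero fun n hn => ?_
  by_cases hv : weight d v n = 0
  · rw [hv, zero_mul]
  · obtain ⟨i, hi⟩ := exists_of_weight_ne_zero hv
    have hP : P n := by rw [← h.mod_iff, hi]; exact i.2
    rw [nil_apply, Finset.sum_eq_zero, mul_zero]
    intro l hl
    rw [Finset.mem_filter] at hl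
    exact absurd hP (hl.2 ▸ h.not_nextFree l)

theorem IsPattern.nil_shift (h : IsPattern d P) (v : {i : Fin d // P i} → k) (f : ℕ → k) :
    nil v (shift d f) = shift d (nil v f) := by
  funext m
  by_cases hm : d ≤ m
  · obtain ⟨l, rfl⟩ : ∃ l, m = l + d := ⟨m - d, by omega⟩
    rw [shift_add_apply, nil_apply, nil_apply]
    symm
    refine Finset.sum_of_injOn (· + d) (fun _ _ _ _ h => Nat.add_right_cancel h) ?_ ?_ ?_
    · intro n hn
      simp only [Finset.coe_filter, Finset.mem_range, Set.mem_ofPred_eq] at hn ⊢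
      rw [h.nextFree_add]
      omega
    · intro n hn hn'
      rw [shift_apply, if_neg, mul_zero]
      intro hdn
      refine hn' ⟨n - d, ?_, by simp only; omega⟩
      simp only [Finset.coe_filter, Finset.mem_filter, Finset.mem_range, Set.mem_ofPred_eq] at hn ⊢
      have := h.nextFree_add (n - d)
      rw [Nat.sub_add_cancel hdn] at this
      omega
    · intro n _
      rw [weight_add, shift_add_apply]
  · rw [shift_apply, if_neg hm, nil_apply]
    refine Finset.sum_eq_zero fun n hn => ?_
    rw [Finset.mem_filter, Finset.mem_range] at hn
    rw [shift_apply, if_neg (by omega), mul_zero]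

/-- The unipotent transformation `1 + nil v`. -/
def unip (v : {i : Fin d // P i} → k) : (ℕ → k) →ₗ[k] (ℕ → k) := LinearMap.id + nil v

theorem unip_apply (v : {i : Fin d // P i} → k) (f : ℕ → k) : unip v f = f + nil v f := rfl

theorem IsPattern.unip_unip (h : IsPattern d P) (v w : {i : Fin d // P i} → k) (f : ℕ → k) :
    unip v (unip w f) = unip (v + w) f := by
  simp only [unip_apply, map_add, h.nil_nil, nil_add]
  abel

theorem unip_zero (f : ℕ → k) : unip (0 : {i : Fin d // P i} → k) f = f := by
  have : nil (0 : {i : Fin d // P i} → k) f = 0 := by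
    simpa using nil_smul (0 : k) (0 : {i : Fin d // P i} → k) f
  rw [unip_apply, this, add_zero]

theorem IsPattern.unip_neg_unip (h : IsPattern d P) (v : {i : Fin d // P i} → k) (f : ℕ → k) :
    unip (-v) (unip v f) = f := by
  rw [h.unip_unip, neg_add_cancel, unip_zero]

theorem IsPattern.unip_unip_neg (h : IsPattern d P) (v : {i : Fin d // P i} → k) (f : ℕ → k) :
    unip v (unip (-v) f) = f := by
  rw [h.unip_unip, add_neg_cancel, unip_zero]

theorem IsPattern.unip_shift_mul (h : IsPattern d P) (v : {i : Fin d // P i} → k) (r : ℕ)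
    (f : ℕ → k) : unip v (shift (r * d) f) = shift (r * d) (unip v f) := by
  induction r with
  | zero =>
    have (f : ℕ → k) : shift (0 * d) f = f := by funext n; simp [shift_apply]
    rw [this, this]
  | succ r ih =>
    rw [Nat.succ_mul, add_comm, ← shift_shift, unip_apply, h.nil_shift, ← map_add, ← unip_apply,
      ih, shift_shift]

/-- `nil v` moves every term strictly to the right; therefore `unip v` preserves orders and tails.
-/
theorem nil_eq_zero_of_le (v : {i : Fin d // P i} → k) {f : ℕ → k} {n : ℕ}
    (hf : ∀ m < n, f m = 0) {m : ℕ} (hm : m ≤ n) : nil v f m = 0 := by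
  rw [nil_apply]
  refine Finset.sum_eq_zero fun l hl => ?_
  rw [Finset.mem_filter, Finset.mem_range] at hl
  rw [hf l (by omega), mul_zero]

theorem HasOrder.unip {f : ℕ → k} {n : ℕ} (hf : HasOrder f n) (v : {i : Fin d // P i} → k) :
    HasOrder (unip v f) n := by
  refine ⟨?_, fun m hm => ?_⟩
  · rw [unip_apply, Pi.add_apply, nil_eq_zero_of_le v hf.2 le_rfl, add_zero]
    exact hf.1
  · rw [unip_apply, Pi.add_apply, nil_eq_zero_of_le v hf.2 hm.le, add_zero, hf.2 m hm]

theorem IsPattern.orders_comap_unip (h : IsPattern d P) (v : {i : Fin d // P i} → k)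
    (N : Submodule k (ℕ → k)) : orders (N.comap (unip v)) = orders N := by
  ext n
  constructor
  · rintro ⟨f, hf, hn⟩
    exact ⟨_, hf, hn.unip v⟩
  · rintro ⟨f, hf, hn⟩
    refine ⟨unip (-v) f, ?_, hn.unip (-v)⟩
    rwa [Submodule.mem_comap, h.unip_unip_neg]

theorem IsPattern.comap_unip_mem_stratum (h : IsPattern d P) (v : {i : Fin d // P i} → k)
    {Λ : Set ℕ} {N : Submodule k (ℕ → k)} (hN : N ∈ stratum k d Λ) :
    N.comap (unip v) ∈ stratum k d Λ := by
  obtain ⟨hs, ⟨M, hM⟩, rfl⟩ := hN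
  refine ⟨fun f hf => ?_, ⟨M, fun f hf => hM fun m hm => ?_⟩, h.orders_comap_unip v N⟩
  · rw [Submodule.mem_comap, Submodule.mem_comap, h.unip_shift_mul, h.unip_shift_mul]
    exact hs _ hf
  · rw [unip_apply, Pi.add_apply, nil_eq_zero_of_le v hf hm.le, add_zero, hf m hm]

/-- Triangularity: `v` is determined by the coefficients of the `nil v (f i)` at the free
positions next to the orders of the `f i`. -/
theorem IsPattern.eq_zero_of_nil_eq_zero (h : IsPattern d P) {E : {i : Fin d // P i} → ℕ}
    (hE : ∀ i, E i % d = i) {f : {i : Fin d // P i} → ℕ → k} (hf : ∀ i, HasOrder (f i) (E i))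
    {v : {i : Fin d // P i} → k} (hv : ∀ i, nil v (f i) (nextFree P (E i)) = 0) : v = 0 := by
  by_contra hne
  obtain ⟨i₀, hi₀⟩ := Function.ne_iff.mp hne
  -- Take `v i ≠ 0` with the smallest gap. A contribution to the same free position from some `n > E
  -- i` comes from a class with a smaller gap, hence of weight zero, and before `E i` the sequence
  -- `f i` vanishes. Only the term at `E i` is left.
  obtain ⟨i, hi, hmin⟩ := exists_minimalFor_of_wellFoundedLT (fun i => v i ≠ 0)
    (fun i => nextFree P (E i) - E i) ⟨i₀, hi₀⟩
  have hlt := h.lt_nextFree (E i)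
  have := hv i
  rw [nil_apply, Finset.sum_eq_single (E i)] at this
  · rw [weight_eq v i (hE i)] at this
    exact mul_ne_zero hi (hf i).1 this
  · intro n hn hne
    rw [Finset.mem_filter, Finset.mem_range] at hn
    rcases lt_or_gt_of_ne hne with hlt' | hgt
    · rw [(hf i).2 n hlt', mul_zero]
    · by_cases hw : weight d v n = 0
      · rw [hw, zero_mul]
      · obtain ⟨i', hi'⟩ := exists_of_weight_ne_zero hw
        rw [weight_eq v i' hi'] at hw
        have hsub := h.nextFree_sub (hi'.trans (hE i').symm)
        have := hmin (j := i') hw (by simp only; omega)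
        simp only at this
        omega
  · intro hE'
    exact absurd (by simpa using hlt) hE'

/-- The conditions are affine in `v`, as many as there are parameters, and their linear part is
injective by triangularity. -/
theorem IsPattern.exists_unip_eq_zero (h : IsPattern d P) {E : {i : Fin d // P i} → ℕ}
    (hE : ∀ i, E i % d = i) {f : {i : Fin d // P i} → ℕ → k} (hf : ∀ i, HasOrder (f i) (E i)) :
    ∃ v : {i : Fin d // P i} → k, ∀ i, unip v (f i) (nextFree P (E i)) = 0 := by
  let L : ({i : Fin d // P i} → k) →ₗ[k] ({i : Fin d // P i} → k) :=
    { toFun := fun v i => nil v (f i) (nextFree P (E i))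
      map_add' := fun v w => by funext i; simp [nil_add]
      map_smul' := fun c v => by funext i; simp [nil_smul] }
  have hinj : Function.Injective L := by
    rw [injective_iff_map_eq_zero]
    exact fun v hv => h.eq_zero_of_nil_eq_zero hE hf fun i => congrFun hv i
  obtain ⟨v, hv⟩ := LinearMap.injective_iff_surjective.mp hinj
    (fun i => -f i (nextFree P (E i)))
  refine ⟨v, fun i => ?_⟩
  have : nil v (f i) (nextFree P (E i)) = -f i (nextFree P (E i)) := congrFun hv i
  rw [unip_apply, Pi.add_apply, this, add_neg_cancel]

end Unipotent

/-! ### Comparison of the strata of a set of orders and of the slid set -/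

section Count

variable {k : Type*} [Field k] {d : ℕ} [NeZero d] {P : ℕ → Prop} {Λ : Set ℕ}
  {E : {i : Fin d // P i} → ℕ} {X : ℕ}

/-- The set of orders `Λ` has its free elements far beyond the first elements `E i` of the residue
classes in `P`. -/
structure Separated (d : ℕ) [NeZero d] (P : ℕ → Prop) (Λ : Set ℕ) (E : {i : Fin d // P i} → ℕ)
    (X : ℕ) : Prop where
  mod_eq : ∀ i, E i % d = i
  mem : ∀ i, E i ∈ Λ
  lt : ∀ i, E i + 3 * d < X
  exists_eq : ∀ m ∈ Λ, P m → ∃ i r, m = E i + r * d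
  le_of_free : ∀ m ∈ Λ, ¬ P m → X ≤ m
  mem_of_le : ∀ m, P m → X ≤ m → m ∈ Λ

theorem Separated.prop (h : IsPattern d P) (hΛ : Separated d P Λ E X)
    (i : {i : Fin d // P i}) : P (E i) := by
  rw [← h.mod_iff, hΛ.mod_eq]; exact i.2

theorem IsPattern.mem_slide_image_iff (h : IsPattern d P) {m : ℕ} (hm : P m) :
    m ∈ slide P '' Λ ↔ m ∈ Λ := by
  constructor
  · rintro ⟨n, hn, rfl⟩
    rw [h.slide_mem_iff] at hm
    rwa [slide_of_mem hm]
  · exact fun hmΛ => ⟨m, hmΛ, slide_of_mem hm⟩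

/-- A free leading term may jump over blocked positions. These lie beyond `X`, so they are orders of
`N`, and elements with these orders have after sliding no term at the landing place; they eliminate
what was jumped over. -/
theorem Separated.orders_map_slideSeq (h : IsPattern d P) (hΛ : Separated d P Λ E X)
    {N : Submodule k (ℕ → k)} (hN : orders N = Λ) :
    orders (N.map (slideSeq k P)) = slide P '' Λ := by
  ext t
  constructor
  · rintro ⟨_, ⟨g, hg, rfl⟩, ht⟩
    by_cases htr : t ∈ Set.range (slide P)
    · obtain ⟨s, rfl⟩ := htr
      refine ⟨s, ?_, rfl⟩
      have hgs : g s ≠ 0 := by simpa [h.slideSeq_slide] using ht.1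
      obtain ⟨n, hns, hn⟩ := exists_hasOrder hgs
      have hnΛ : n ∈ Λ := hN ▸ ⟨g, hg, hn⟩
      rcases hns.lt_or_eq with hlt | rfl
      · have hge : slide P s ≤ slide P n := by
          by_contra hlt'
          have := ht.2 _ (not_le.mp hlt')
          rw [h.slideSeq_slide] at this
          exact hn.1 this
        have hPn : ¬ P n := fun hPn => by
          rw [slide_of_mem hPn] at hge
          exact absurd (h.le_slide s) (by omega)
        have hPs : P s := by
          by_contra hPs
          rw [slide_of_free hPs, slide_of_free hPn] at hge
          exact absurd (h.nextFree_lt hlt hPs) (not_lt.mpr hge)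
        exact hΛ.mem_of_le s hPs ((hΛ.le_of_free n hnΛ hPn).trans hlt.le)
      · exact hnΛ
    · exact absurd (slideSeq_of_not_mem g htr) ht.1
  · rintro ⟨n, hn, rfl⟩
    obtain ⟨g, hg, hgn⟩ : n ∈ orders N := hN ▸ hn
    have hmem : slideSeq k P g ∈ N.map (slideSeq k P) := Submodule.mem_map_of_mem hg
    by_cases hP : P n
    · rw [slide_of_mem hP]
      refine ⟨_, hmem, ?_, fun m hm => h.slideSeq_eq_zero hgn.2 hm⟩
      rw [h.slideSeq_of_mem g hP]
      exact hgn.1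
    · refine mem_orders_of_eliminate hmem (a := n + 1) (fun m hm => ?_) ?_ fun m _ hnm hmt => ?_
      · rcases Nat.lt_succ_iff_lt_or_eq.mp hm with hm | rfl
        · exact h.slideSeq_eq_zero hgn.2 hm
        · exact h.slideSeq_eq_zero_of_free hgn.2 le_rfl hP
      · rw [h.slideSeq_slide]; exact hgn.1
      · rw [slide_of_free hP] at hmt ⊢
        have hPm : P m := of_lt_nextFree hnm hmt
        obtain ⟨f, hf, hfm⟩ : m ∈ orders N := by
          rw [hN]
          exact hΛ.mem_of_le m hPm ((hΛ.le_of_free n hn hP).trans (by omega))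
        refine ⟨slideSeq k P f, ⟨Submodule.mem_map_of_mem hf, ?_⟩, ?_,
          fun l hl => h.slideSeq_eq_zero hfm.2 hl⟩
        · rw [SetLike.mem_coe, mem_vanishing, h.slideSeq_nextFree f hP]
          exact hfm.2 n hnm
        · rw [h.slideSeq_of_mem f hPm]; exact hfm.1

theorem Separated.map_slideSeq_mem_stratum (h : IsPattern d P) (hΛ : Separated d P Λ E X)
    {N : Submodule k (ℕ → k)} (hN : N ∈ stratum k d Λ) :
    N.map (slideSeq k P) ∈ stratum k d (slide P '' Λ) := by
  obtain ⟨hs, ⟨M, hM⟩, hN⟩ := hN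
  refine ⟨?_, ?_, hΛ.orders_map_slideSeq h hN⟩
  · rintro _ ⟨g, hg, rfl⟩
    rw [← h.slideSeq_shift_mul, ← h.slideSeq_shift_mul]
    exact ⟨Submodule.mem_map_of_mem (hs g hg).1, Submodule.mem_map_of_mem (hs g hg).2⟩
  · obtain ⟨t, ht⟩ := h.exists_compl_range_slide
    -- This bound exceeds `slide P m` for all `m < M` as well as the missed position `t`.
    refine ⟨(∑ m ∈ Finset.range M, slide P m) + t + 1, fun f hf => ?_⟩
    refine ⟨fun n => f (slide P n), hM fun m hm => hf _ ?_, h.slideSeq_comp_slide fun s hs => ?_⟩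
    · have := Finset.single_le_sum (f := slide P) (fun _ _ => Nat.zero_le _)
        (Finset.mem_range.mpr hm)
      omega
    · have : s ∈ ({t} : Set ℕ) := ht ▸ hs
      rw [Set.mem_singleton_iff] at this
      exact hf s (by omega)

/-- The coefficients at the free positions next to the `E i` vanish in a slid subspace. -/
theorem Separated.apply_nextFree_eq_zero (h : IsPattern d P) (hΛ : Separated d P Λ E X)
    {N : Submodule k (ℕ → k)} (hN : orders N = Λ) {i : {i : Fin d // P i}} {f : ℕ → k}
    (hf : f ∈ N.map (slideSeq k P)) (hfi : HasOrder f (E i)) : f (nextFree P (E i)) = 0 := by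
  obtain ⟨g, hg, rfl⟩ := hf
  by_cases hr : nextFree P (E i) ∈ Set.range (slide P)
  · obtain ⟨n, hn⟩ := hr
    have hPn : ¬ P n := by
      rw [← h.slide_mem_iff, hn]; exact h.not_nextFree _
    rw [← hn, h.slideSeq_slide]
    have hlt : n < E i := by
      rw [slide_of_free hPn] at hn
      rcases lt_trichotomy n (E i) with hlt | rfl | hgt
      · exact hlt
      · exact absurd (hΛ.prop h i) hPn
      · exact absurd hn (h.nextFree_lt hgt hPn).ne'
    -- Otherwise `g` has an order below `E i`. It is blocked, since free orders begin at `X`, so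
    -- sliding keeps it, against the order of the slid sequence.
    by_contra hgn
    obtain ⟨m, hmn, hm⟩ := exists_hasOrder hgn
    have hmΛ : m ∈ Λ := hN ▸ ⟨g, hg, hm⟩
    have hPm : P m := by
      by_contra hPm
      have := hΛ.le_of_free m hmΛ hPm
      have := hΛ.lt i
      omega
    have := hfi.2 m (by omega)
    rw [h.slideSeq_of_mem g hPm] at this
    exact hm.1 this
  · exact slideSeq_of_not_mem g hr

section Surjective

variable {N : Submodule k (ℕ → k)}

/-- If each `E i` is the order of an element of `N` without term at the next free position, the
same holds for all orders in `P`. -/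
theorem Separated.mem_orders_vanishing (h : IsPattern d P) (hΛ : Separated d P Λ E X)
    (hN : N ∈ stratum k d (slide P '' Λ))
    (hE : ∀ i, E i ∈ orders (N ⊓ vanishing k (nextFree P (E i)))) {m : ℕ} (hm : m ∈ Λ)
    (hP : P m) : m ∈ orders (N ⊓ vanishing k (nextFree P m)) := by
  obtain ⟨hs, -, hN⟩ := hN
  obtain ⟨s, hsm⟩ : ∃ s, X - m = s := ⟨_, rfl⟩
  -- Descending induction on `m`: the claim for `E i + d` uses the claim for blocked orders beyond
  -- `E i + 3 * d`.
  induction s using Nat.strong_induction_on generalizing m with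
  | _ s ih =>
    obtain ⟨i, r, rfl⟩ := hΛ.exists_eq m hm hP
    obtain ⟨f, ⟨hf, hfv⟩, hfi⟩ := hE i
    -- `E i + d` is the one position of the class that multiples of `f` by powers of `T` in `R` do
    -- not reach.
    by_cases hr : r = 1
    · subst hr
      rw [one_mul] at hm hP hsm ⊢
      obtain ⟨g, hg, hgo⟩ : E i + d ∈ orders N := by
        rw [hN, h.mem_slide_image_iff hP]; exact hm
      refine ⟨g, ⟨hg, ?_⟩, hgo⟩
      rw [SetLike.mem_coe, mem_vanishing]
      by_contra hne
      have hlt := hΛ.lt i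
      have hnf := h.nextFree_add (E i)
      have hnf3 := h.nextFree_add_mul (E i) 3
      have hilt := h.lt_nextFree (E i)
      rw [SetLike.mem_coe, mem_vanishing] at hfv
      -- compare `T² g` with `T³ f`
      have hmem : nextFree P (E i) + 3 * d ∈ orders N := by
        refine mem_orders_of_eliminate (f := shift (2 * d) g - (g (E i + d) / f (E i)) •
          shift (3 * d) f) (a := E i + 3 * d + 1)
          (N.sub_mem (hs g hg).1 (N.smul_mem _ (hs f hf).2)) (fun l hl => ?_) ?_
          fun l hl hal hlt' => ?_
        · rcases Nat.lt_succ_iff_lt_or_eq.mp hl with hl | rfl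
          · have h1 := (hgo.shift (2 * d)).2 l (by omega)
            have h2 := (hfi.shift (3 * d)).2 l hl
            simp [h1, h2]
          · have h1 : shift (2 * d) g (E i + 3 * d) = g (E i + d) := by
              rw [← shift_add_apply (2 * d) g]; exact congrArg _ (by omega)
            rw [Pi.sub_apply, Pi.smul_apply, h1, shift_add_apply, smul_eq_mul,
              div_mul_cancel₀ _ hfi.1, sub_self]
        · have h1 : shift (2 * d) g (nextFree P (E i) + 3 * d) = g (nextFree P (E i + d)) := by
            rw [← shift_add_apply (2 * d) g, hnf]; exact congrArg _ (by omega)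
          rw [Pi.sub_apply, Pi.smul_apply, h1, shift_add_apply, hfv, smul_zero, sub_zero]
          exact hne
        · rw [← hnf3] at hlt'
          have hPl : P l := of_lt_nextFree (n := E i + 3 * d) (by omega) hlt'
          have hlΛ : l ∈ Λ := by rwa [hN, h.mem_slide_image_iff hPl] at hl
          have hnl := h.nextFree_eq_of_between (n := E i + 3 * d) (m := l) (by omega) hlt'
          have := ih (X - l) (by omega) hlΛ hPl rfl
          rwa [hnl, hnf3] at this
      rw [hN] at hmem
      obtain ⟨n, hn, hn'⟩ := hmem
      -- The new order would be the slide of a free `n ≥ X > E i + 3 * d`, but such slides land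
      -- beyond the free position next to `E i + 3 * d`. This is where the margin `3 * d` is needed.
      have hPn : ¬ P n := by
        rw [← h.slide_mem_iff, hn', h.periodic_mul]
        exact h.not_nextFree _
      have := hΛ.le_of_free n hn hPn
      have := h.nextFree_lt (n := E i + 3 * d) (m := n) (by omega) hPn
      rw [slide_of_free hPn] at hn'
      omega
    · refine ⟨shift (r * d) f, ⟨shift_mem hs hf r hr, ?_⟩, hfi.shift _⟩
      rw [SetLike.mem_coe, mem_vanishing, h.nextFree_add_mul, shift_add_apply]
      exact hfv

/-- All positions before the missed position `t` are blocked. If `f t ≠ 0`, normalized elements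
eliminate them and make `t` an order, although no slide lands on `t`. -/
theorem Separated.apply_eq_zero (h : IsPattern d P) (hΛ : Separated d P Λ E X)
    (hN : N ∈ stratum k d (slide P '' Λ))
    (hE : ∀ i, E i ∈ orders (N ⊓ vanishing k (nextFree P (E i)))) {f : ℕ → k} (hf : f ∈ N)
    {t : ℕ} (ht : t ∉ Set.range (slide P)) : f t = 0 := by
  by_contra hne
  have ht' := h.not_mem_range_slide_iff.mp ht
  have : t ∈ orders N := by
    refine mem_orders_of_eliminate hf (a := 0) (fun m hm => absurd hm (Nat.not_lt_zero m)) hne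
      fun m hm _ hmt => ?_
    have hP := ht'.2 m hmt
    rw [hN.2.2, h.mem_slide_image_iff hP] at hm
    have := hΛ.mem_orders_vanishing h hN hE hm hP
    rwa [h.nextFree_eq hmt ht'.1 fun l _ hl => ht'.2 l hl] at this
  rw [hN.2.2] at this
  obtain ⟨n, -, rfl⟩ := this
  exact ht ⟨n, rfl⟩

/-- A normalized subspace lies in the range of `slideSeq`, so its preimage is the candidate; the
work is to see that unsliding turns the orders back into `Λ`. -/
theorem Separated.exists_map_slideSeq_eq (h : IsPattern d P) (hΛ : Separated d P Λ E X)
    (hN : N ∈ stratum k d (slide P '' Λ))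
    (hE : ∀ i, E i ∈ orders (N ⊓ vanishing k (nextFree P (E i)))) :
    ∃ N₀ ∈ stratum k d Λ, N₀.map (slideSeq k P) = N := by
  have hcomp {f : ℕ → k} (hf : f ∈ N) : slideSeq k P (fun n => f (slide P n)) = f :=
    h.slideSeq_comp_slide fun t ht => hΛ.apply_eq_zero h hN hE hf ht
  refine ⟨N.comap (slideSeq k P), ⟨fun g hg => ?_, ?_, ?_⟩, ?_⟩
  · rw [Submodule.mem_comap, Submodule.mem_comap, h.slideSeq_shift_mul, h.slideSeq_shift_mul]
    exact hN.1 _ hg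
  · obtain ⟨M, hM⟩ := hN.2.1
    exact ⟨M, fun g hg => hM fun m hm => h.slideSeq_eq_zero hg hm⟩
  · ext n
    constructor
    · rintro ⟨g, hg, hgn⟩
      rw [Submodule.mem_comap] at hg
      by_cases hP : P n
      · rw [← h.mem_slide_image_iff hP, ← hN.2.2]
        refine ⟨_, hg, ?_, fun m hm => h.slideSeq_eq_zero hgn.2 hm⟩
        rw [h.slideSeq_of_mem g hP]; exact hgn.1
      · have : nextFree P n ∈ orders N := by
          refine mem_orders_of_eliminate hg (a := n + 1) (fun m hm => ?_) ?_
            fun m hm hnm hmt => ?_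
          · rcases Nat.lt_succ_iff_lt_or_eq.mp hm with hm | rfl
            · exact h.slideSeq_eq_zero hgn.2 hm
            · exact h.slideSeq_eq_zero_of_free hgn.2 le_rfl hP
          · rw [h.slideSeq_nextFree g hP]; exact hgn.1
          · have hPm : P m := of_lt_nextFree hnm hmt
            rw [hN.2.2, h.mem_slide_image_iff hPm] at hm
            have := hΛ.mem_orders_vanishing h hN hE hm hPm
            rwa [h.nextFree_eq_of_between hnm hmt] at this
        rw [hN.2.2, ← slide_of_free hP] at this
        obtain ⟨l, hl, hln⟩ := this
        rwa [← h.slide_injective hln]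
    · intro hn
      by_cases hP : P n
      -- Unsliding may bring the term at the free position next to `n` in front of `n`, so `f` is
      -- chosen without that term.
      · obtain ⟨f, ⟨hf, hfv⟩, hfn⟩ := hΛ.mem_orders_vanishing h hN hE hn hP
        refine ⟨fun m => f (slide P m), ?_, ?_, fun m hm => ?_⟩
        · rw [Submodule.mem_comap, hcomp hf]; exact hf
        · simp only [slide_of_mem hP]; exact hfn.1
        · by_cases hPm : P m
          · simp only [slide_of_mem hPm]; exact hfn.2 m hm
          · simp only [slide_of_free hPm]
            rcases lt_trichotomy (nextFree P m) n with hlt | heq | hgt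
            · exact hfn.2 _ hlt
            · exact absurd (heq ▸ hP) (h.not_nextFree m)
            · rw [← h.nextFree_eq_of_between hm hgt]; exact hfv
      · obtain ⟨f, hf, hfn⟩ : slide P n ∈ orders N := hN.2.2 ▸ ⟨n, hn, rfl⟩
        refine ⟨fun m => f (slide P m), ?_, hfn.1, fun m hm => hfn.2 _ ?_⟩
        · rw [Submodule.mem_comap, hcomp hf]; exact hf
        · rw [slide_of_free hP]
          by_cases hPm : P m
          · rw [slide_of_mem hPm]; exact hm.trans (h.lt_nextFree n)
          · rw [slide_of_free hPm]; exact h.nextFree_lt hm hP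
  · refine le_antisymm (Submodule.map_comap_le _ _) fun f hf => ?_
    refine ⟨_, ?_, hcomp hf⟩
    rw [SetLike.mem_coe, Submodule.mem_comap, hcomp hf]
    exact hf

end Surjective

/-- The stratum of the slid set of orders is the product of the stratum of `Λ` and of an affine
space. -/
theorem Separated.bijOn (h : IsPattern d P) (hΛ : Separated d P Λ E X) :
    Set.BijOn (fun p : ({i : Fin d // P i} → k) × Submodule k (ℕ → k) =>
      (p.2.map (slideSeq k P)).comap (unip p.1))
      (Set.univ ×ˢ stratum k d Λ) (stratum k d (slide P '' Λ)) := by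
  refine ⟨?_, ?_, ?_⟩
  · rintro ⟨v, N⟩ ⟨-, hN⟩
    exact h.comap_unip_mem_stratum v (hΛ.map_slideSeq_mem_stratum h hN)
  · rintro ⟨v, N⟩ ⟨-, hN⟩ ⟨w, N'⟩ ⟨-, hN'⟩ heq
    simp only at heq hN hN'
    have key (f : ℕ → k) (hf : f ∈ N.map (slideSeq k P)) :
        unip (w - v) f ∈ N'.map (slideSeq k P) := by
      have : unip (-v) f ∈ (N.map (slideSeq k P)).comap (unip v) := by
        rwa [Submodule.mem_comap, h.unip_unip_neg]
      rw [heq, Submodule.mem_comap, h.unip_unip, ← sub_eq_add_neg] at this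
      exact this
    have hmem (i) : E i ∈ orders (N.map (slideSeq k P)) := by
      rw [hΛ.orders_map_slideSeq h hN.2.2, h.mem_slide_image_iff (hΛ.prop h i)]
      exact hΛ.mem i
    choose f hf hfo using hmem
    -- `unip (w - v)` carries one slid subspace into another. Both are normalized, so triangularity
    -- forces `w = v`.
    have hvw : w - v = 0 := by
      refine h.eq_zero_of_nil_eq_zero hΛ.mod_eq hfo fun i => ?_
      have h1 := hΛ.apply_nextFree_eq_zero h hN.2.2 (hf i) (hfo i)
      have h2 := hΛ.apply_nextFree_eq_zero h hN'.2.2 (key _ (hf i)) ((hfo i).unip _)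
      rwa [unip_apply, Pi.add_apply, h1, zero_add] at h2
    obtain rfl : w = v := sub_eq_zero.mp hvw
    have hsurj : Function.Surjective (unip w : (ℕ → k) →ₗ[k] (ℕ → k)) :=
      fun f => ⟨_, h.unip_unip_neg w f⟩
    have := Submodule.comap_injective_of_surjective hsurj heq
    exact Prod.ext rfl (Submodule.map_injective_of_injective h.slideSeq_injective this)
  · intro N hN
    have hmem (i) : E i ∈ orders N := by
      rw [hN.2.2, h.mem_slide_image_iff (hΛ.prop h i)]
      exact hΛ.mem i
    choose f hf hfo using hmem
    -- Normalize `N` first; the normalized subspace can be unslid.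
    obtain ⟨v, hv⟩ := h.exists_unip_eq_zero hΛ.mod_eq hfo
    obtain ⟨N₀, hN₀, heq⟩ := hΛ.exists_map_slideSeq_eq h (h.comap_unip_mem_stratum (-v) hN)
      fun i => ⟨unip v (f i), ⟨by
        rw [SetLike.mem_coe, Submodule.mem_comap, h.unip_neg_unip]; exact hf i, hv i⟩,
        (hfo i).unip v⟩
    refine ⟨(v, N₀), ⟨trivial, hN₀⟩, ?_⟩
    simp only
    rw [heq]
    ext g
    rw [Submodule.mem_comap, Submodule.mem_comap, h.unip_neg_unip]

theorem Separated.ncard_stratum (h : IsPattern d P) (hΛ : Separated d P Λ E X) [Finite k] :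
    (stratum k d (slide P '' Λ)).ncard =
      Nat.card k ^ Nat.card {i : Fin d // P i} * (stratum k d Λ).ncard := by
  rw [← (hΛ.bijOn (k := k) h).image_eq, (hΛ.bijOn h).injOn.ncard_image, Set.ncard_prod,
    Set.ncard_univ, Nat.card_fun]

end Count

/-! ### Submodules of `𝔪F` as subspaces of sequences -/

section Bridge

variable {k : Type*} [Field k]

/-! ### Ideals of the ring `R` -/

theorem Cusp.val_injective : Function.Injective (Cusp.val : Cusp k → PowerSeries k) :=
  Subtype.val_injective

@[simp]
theorem Cusp.val_mk (f : PowerSeries k) (hf : PowerSeries.coeff 1 f = 0) :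
    (Cusp.mk f hf).val = f := rfl

@[simp]
theorem val_tPow (l : ℕ) : (tPow k l).val = PowerSeries.X ^ (l + 2) := rfl

/-- The exponents of the monomials of `I`, lowered by `2`. -/
def MonIdeal.exps (I : MonIdeal) : Set ℕ :=
  {m | I.level ≤ m ∧ (I.color = Color.J → m ≠ I.level + 1)}

theorem MonIdeal.exps_injective : Function.Injective MonIdeal.exps := by
  rintro ⟨c, l⟩ ⟨c', l'⟩ h
  have h1 : l ∈ MonIdeal.exps ⟨c', l'⟩ := h ▸ ⟨le_rfl, by simp⟩
  have h2 : l' ∈ MonIdeal.exps ⟨c, l⟩ := h ▸ ⟨le_rfl, by simp⟩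
  obtain rfl : l = l' := le_antisymm h2.1 h1.1
  have h3 : l + 1 ∈ MonIdeal.exps ⟨c, l⟩ ↔ l + 1 ∈ MonIdeal.exps ⟨c', l⟩ := by rw [h]
  cases c <;> cases c' <;> simp [MonIdeal.exps] at h3 ⊢

/-- A cofactor `h` in `k[[T]]` need not lie in `R`, but its linear term can be moved to the second
generator. -/
theorem mem_span_tPow_pair {l : ℕ} {r : Cusp k} :
    r ∈ Ideal.span {tPow k l, tPow k (l + 1)} ↔ ∀ m < l + 2, PowerSeries.coeff m r.val = 0 := by
  rw [← PowerSeries.X_pow_dvd_iff, Ideal.mem_span_pair]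
  constructor
  · rintro ⟨a, b, rfl⟩
    rw [map_add, map_mul, map_mul, val_tPow, val_tPow]
    exact dvd_add (Dvd.intro_left _ rfl) (Dvd.dvd.mul_left (pow_dvd_pow _ (by omega)) _)
  · rintro ⟨h, hh⟩
    refine ⟨Cusp.mk (h - PowerSeries.C (PowerSeries.coeff 1 h) * PowerSeries.X) (by simp),
      algebraMap k _ (PowerSeries.coeff 1 h), Cusp.val_injective ?_⟩
    rw [map_add Cusp.val, map_mul Cusp.val, map_mul Cusp.val, val_tPow, val_tPow,
      AlgHom.commutes, hh, Cusp.val_mk, PowerSeries.algebraMap_apply, Algebra.algebraMap_self,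
      RingHom.id_apply]
    ring

theorem mem_span_tPow {l : ℕ} {r : Cusp k} :
    r ∈ Ideal.span {tPow k l} ↔
      (∀ m < l + 2, PowerSeries.coeff m r.val = 0) ∧ PowerSeries.coeff (l + 3) r.val = 0 := by
  rw [← PowerSeries.X_pow_dvd_iff, Ideal.mem_span_singleton']
  constructor
  · rintro ⟨a, rfl⟩
    rw [map_mul, val_tPow]
    refine ⟨Dvd.intro_left _ rfl, ?_⟩
    rw [show l + 3 = 1 + (l + 2) by omega, PowerSeries.coeff_mul_X_pow]
    exact a.coeff_one_val
  · rintro ⟨⟨h, hh⟩, h1⟩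
    rw [hh, show l + 3 = 1 + (l + 2) by omega, PowerSeries.coeff_X_pow_mul] at h1
    refine ⟨Cusp.mk h h1, Cusp.val_injective ?_⟩
    rw [map_mul, val_tPow, hh, Cusp.val_mk, mul_comm]

theorem mem_toIdeal {I : MonIdeal} {r : Cusp k} :
    r ∈ I.toIdeal k ↔ PowerSeries.coeff 0 r.val = 0 ∧
      ∀ m ∉ I.exps, PowerSeries.coeff (m + 2) r.val = 0 := by
  obtain ⟨c, l⟩ := I
  cases c
  · rw [MonIdeal.toIdeal, mem_span_tPow]
    constructor
    · refine fun h => ⟨h.1 0 (by omega), fun m hm => ?_⟩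
      by_cases hml : m = l + 1
      · rw [hml]; exact h.2
      · exact h.1 _ (by simp only [MonIdeal.exps, Set.mem_ofPred_eq] at hm; grind)
    · refine fun h => ⟨fun m hm => ?_, h.2 (l + 1) (by simp [MonIdeal.exps])⟩
      match m with
      | 0 => exact h.1
      | 1 => exact r.coeff_one_val
      | m + 2 => exact h.2 m (by simp only [MonIdeal.exps, Set.mem_ofPred_eq]; grind)
  · rw [MonIdeal.toIdeal, mem_span_tPow_pair]
    constructor
    · refine fun h => ⟨h 0 (by omega), fun m hm => h _ ?_⟩
      simp only [MonIdeal.exps, Set.mem_ofPred_eq] at hm; grind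
    · intro h m hm
      match m with
      | 0 => exact h.1
      | 1 => exact r.coeff_one_val
      | m + 2 => exact h.2 m (by simp only [MonIdeal.exps, Set.mem_ofPred_eq]; grind)

theorem mem_maxIdeal {r : Cusp k} : r ∈ maxIdeal k ↔ PowerSeries.coeff 0 r.val = 0 := by
  rw [maxIdeal, mem_span_tPow_pair (l := 0)]
  refine ⟨fun h => h 0 (by omega), fun h m hm => ?_⟩
  match m with
  | 0 => exact h
  | 1 => exact r.coeff_one_val

/-- The inverse in `k[[T]]` of a series with nonzero constant and no linear term again has no linear
term. This makes Nakayama's lemma available. -/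
theorem maxIdeal_le_jacobson : maxIdeal k ≤ (⊥ : Ideal (Cusp k)).jacobson := by
  intro r hr
  rw [Ideal.mem_jacobson_bot]
  intro y
  rw [mem_maxIdeal, PowerSeries.coeff_zero_eq_constantCoeff_apply] at hr
  have h0 : PowerSeries.constantCoeff (r * y + 1).val ≠ 0 := by
    rw [map_add, map_mul, map_one]
    simp [hr]
  have hinv := PowerSeries.mul_inv_cancel _ h0
  have h1 : PowerSeries.coeff 1 ((r * y + 1).val)⁻¹ = 0 := by
    have := congrArg (PowerSeries.coeff 1) hinv
    rw [PowerSeries.coeff_one_mul, Cusp.coeff_one_val, zero_mul, zero_add] at this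
    rw [PowerSeries.coeff_one, if_neg one_ne_zero] at this
    exact (mul_eq_zero.mp this).resolve_right h0
  exact IsUnit.of_mul_eq_one (Cusp.mk _ h1)
    (Cusp.val_injective (by rw [map_mul, Cusp.val_mk, hinv, map_one]))

/-! ### Coefficient sequences of elements of `𝔪F` -/

variable {d : ℕ}

theorem mem_mF {f : Free k d} : f ∈ mF k d ↔ ∀ i, PowerSeries.coeff 0 (f i).val = 0 := by
  simp_rw [← mem_maxIdeal]
  constructor
  · intro hf i
    refine Submodule.smul_induction_on hf (fun r hr g _ => ?_) fun _ _ hf hg => ?_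
    · exact Ideal.mul_mem_right _ _ hr
    · exact add_mem hf hg
  · intro hf
    rw [pi_eq_sum_univ f]
    exact sum_mem fun i _ => Submodule.smul_mem_smul (hf i) trivial

/-- The element of `𝔪F` with coefficients `g`: the index `d * l + i` belongs to `T^(l+2) u_i`. -/
def toFree (d : ℕ) : (ℕ → k) →ₗ[k] Free k d where
  toFun g i := Cusp.mk (PowerSeries.mk fun m => if 2 ≤ m then g (d * (m - 2) + i) else 0)
    (by simp)
  map_add' g g' := by
    funext i
    refine Cusp.val_injective (PowerSeries.ext fun m => ?_)
    change _ = PowerSeries.coeff m (Cusp.mk _ _ + Cusp.mk _ _).val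
    rw [map_add Cusp.val, map_add]
    simp only [Cusp.val_mk, PowerSeries.coeff_mk, Pi.add_apply]
    split_ifs <;> simp
  map_smul' c g := by
    funext i
    refine Cusp.val_injective (PowerSeries.ext fun m => ?_)
    change _ = PowerSeries.coeff m (c • Cusp.mk _ _).val
    rw [map_smul Cusp.val, map_smul]
    simp only [Cusp.val_mk, PowerSeries.coeff_mk, Pi.smul_apply]
    split_ifs <;> simp

theorem coeff_toFree (g : ℕ → k) (i : Fin d) (m : ℕ) :
    PowerSeries.coeff m (toFree d g i).val = if 2 ≤ m then g (d * (m - 2) + i) else 0 :=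
  PowerSeries.coeff_mk m fun m => if 2 ≤ m then g (d * (m - 2) + i) else 0

theorem coeff_add_two_toFree (g : ℕ → k) (i : Fin d) (m : ℕ) :
    PowerSeries.coeff (m + 2) (toFree d g i).val = g (d * m + i) := by
  rw [coeff_toFree, if_pos (by omega), Nat.add_sub_cancel]

theorem toFree_mem_mF (g : ℕ → k) : toFree d g ∈ mF k d := by
  rw [mem_mF]
  intro i
  rw [coeff_toFree, if_neg (by omega)]

/-- The subspace of sequences given by a submodule of `F`. -/
def seqSub (N : Submodule (Cusp k) (Free k d)) : Submodule k (ℕ → k) where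
  carrier := {g | toFree d g ∈ N}
  add_mem' hf hg := by
    rw [Set.mem_ofPred_eq, map_add]
    exact N.add_mem hf hg
  zero_mem' := by rw [Set.mem_ofPred_eq, map_zero]; exact N.zero_mem
  smul_mem' c f hf := by
    rw [Set.mem_ofPred_eq, map_smul, ← algebraMap_smul (Cusp k) c]
    exact N.smul_mem _ hf

theorem mem_seqSub {N : Submodule (Cusp k) (Free k d)} {g : ℕ → k} :
    g ∈ seqSub N ↔ toFree d g ∈ N := Iff.rfl

/-- The submodule `T^(M+2) k[[T]]^d`. -/
def freeTail (k : Type*) [Field k] (d M : ℕ) : Submodule (Cusp k) (Free k d) :=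
  Submodule.pi Set.univ fun _ => Ideal.span {tPow k M, tPow k (M + 1)}

theorem freeTail_le_smul (M : ℕ) : freeTail k d (M + 2) ≤ maxIdeal k • freeTail k d M := by
  intro f hf
  have hf' : ∀ i, ∃ g, (f i).val = PowerSeries.X ^ (M + 4) * g := by
    intro i
    exact PowerSeries.X_pow_dvd_iff.mpr (mem_span_tPow_pair.mp (hf i trivial))
  choose g hg using hf'
  have hc (i) : PowerSeries.coeff 1 (PowerSeries.X ^ (M + 2) * g i) = 0 :=
    PowerSeries.X_pow_dvd_iff.mp (Dvd.intro _ rfl) 1 (by omega)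
  have : f = tPow k 0 • fun i => Cusp.mk _ (hc i) := by
    funext i
    refine Cusp.val_injective ?_
    rw [Pi.smul_apply, smul_eq_mul, map_mul, val_tPow, Cusp.val_mk, hg]
    ring
  rw [this]
  refine Submodule.smul_mem_smul (Ideal.subset_span (by simp)) fun i _ => ?_
  exact mem_span_tPow_pair.mpr (PowerSeries.X_pow_dvd_iff.mp (Dvd.intro _ rfl))

theorem fg_freeTail (M : ℕ) : (freeTail k d M).FG :=
  Submodule.fg_pi fun _ => Submodule.fg_span (Set.toFinite _)

variable [NeZero d]

/-- The sequence of coefficients of an element of `𝔪F`. -/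
def toSeq (f : Free k d) (n : ℕ) : k := PowerSeries.coeff (n / d + 2) (f (Fin.ofNat d n)).val

theorem toSeq_toFree (g : ℕ → k) : toSeq (toFree d g) = g := by
  funext n
  rw [toSeq, coeff_add_two_toFree, Fin.val_ofNat, Nat.div_add_mod]

theorem mul_add_div_mod (l : ℕ) (i : Fin d) :
    (d * l + i) / d = l ∧ Fin.ofNat d (d * l + i) = i := by
  refine ⟨?_, Fin.ext ?_⟩
  · rw [Nat.mul_add_div (NeZero.pos d), Nat.div_eq_of_lt i.2, add_zero]
  · simp [Nat.mod_eq_of_lt i.2]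

theorem toSeq_apply (f : Free k d) (l : ℕ) (i : Fin d) :
    toSeq f (d * l + i) = PowerSeries.coeff (l + 2) (f i).val := by
  rw [toSeq, (mul_add_div_mod l i).1, (mul_add_div_mod l i).2]

theorem toFree_toSeq {f : Free k d} (hf : f ∈ mF k d) : toFree d (toSeq f) = f := by
  funext i
  refine Cusp.val_injective (PowerSeries.ext fun m => ?_)
  match m with
  | 0 => rw [coeff_toFree, if_neg (by omega), mem_mF.mp hf i]
  | 1 => rw [Cusp.coeff_one_val, Cusp.coeff_one_val]
  | m + 2 => rw [coeff_add_two_toFree, toSeq_apply]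

/-- Multiplication by `T^a` is the shift by `a * d`. The range comes from the degree `n / d + 2` of
the coefficient; the terms with `a > n / d` are zero. -/
theorem toSeq_smul_toFree (r : Cusp k) (g : ℕ → k) (n : ℕ) :
    toSeq (r • toFree d g) n = ∑ a ∈ Finset.range (n / d + 3),
      PowerSeries.coeff a r.val * shift (a * d) g n := by
  rw [toSeq, Pi.smul_apply, smul_eq_mul, map_mul, PowerSeries.coeff_mul,
    Finset.Nat.sum_antidiagonal_eq_sum_range_succ
      (fun a b => PowerSeries.coeff a r.val * PowerSeries.coeff b (toFree d g _).val)]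
  refine Finset.sum_congr rfl fun a ha => ?_
  congr 1
  rw [coeff_toFree, shift_apply, Fin.val_ofNat]
  have hiff : 2 ≤ n / d + 2 - a ↔ a * d ≤ n := by
    rw [← Nat.le_div_iff_mul_le (NeZero.pos d)]
    rw [Finset.mem_range] at ha
    omega
  split_ifs with h1 h2 h2
  · congr 1
    have hn := Nat.div_add_mod n d
    obtain ⟨c, hc⟩ : ∃ c, n / d = c + a :=
      ⟨n / d - a, by rw [← Nat.le_div_iff_mul_le (NeZero.pos d)] at h2; omega⟩
    rw [hc] at hn ⊢
    rw [show c + a + 2 - a - 2 = c by omega]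
    have : d * (c + a) = d * c + a * d := by ring
    omega
  · exact absurd (hiff.mp h1) h2
  · exact absurd (hiff.mpr h2) h1
  · rfl

theorem toFree_shift (l : ℕ) (g : ℕ → k) :
    toFree d (shift ((l + 2) * d) g) = tPow k l • toFree d g := by
  have hmem : tPow k l • toFree d g ∈ mF k d := (mF k d).smul_mem _ (toFree_mem_mF g)
  rw [← toFree_toSeq hmem]
  congr 1
  funext n
  rw [toSeq_smul_toFree, val_tPow]
  simp only [PowerSeries.coeff_X_pow, ite_mul, one_mul, zero_mul]
  rw [Finset.sum_ite_eq' (Finset.range (n / d + 3)) (l + 2)]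
  split_ifs with h
  · rfl
  · rw [shift_apply, if_neg]
    rw [← Nat.le_div_iff_mul_le (NeZero.pos d)]
    simp only [Finset.mem_range] at h
    omega

theorem toSeq_mem_seqSub {N : Submodule (Cusp k) (Free k d)} (hN : N ≤ mF k d) {f : Free k d}
    (hf : f ∈ N) : toSeq f ∈ seqSub N := by
  rwa [mem_seqSub, toFree_toSeq (hN hf)]

theorem eq_of_seqSub_eq {N N' : Submodule (Cusp k) (Free k d)} (hN : N ≤ mF k d)
    (hN' : N' ≤ mF k d) (h : seqSub N = seqSub N') : N = N' := by
  ext f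
  constructor
  · intro hf
    have := toSeq_mem_seqSub hN hf
    rwa [h, mem_seqSub, toFree_toSeq (hN hf)] at this
  · intro hf
    have := toSeq_mem_seqSub hN' hf
    rwa [← h, mem_seqSub, toFree_toSeq (hN' hf)] at this

theorem shift_mem_seqSub {N : Submodule (Cusp k) (Free k d)} {g : ℕ → k} (hg : g ∈ seqSub N) :
    shift (2 * d) g ∈ seqSub N ∧ shift (3 * d) g ∈ seqSub N := by
  rw [mem_seqSub, mem_seqSub]
  have h0 := toFree_shift (d := d) 0 g
  have h1 := toFree_shift (d := d) 1 g
  simp only [zero_add, Nat.reduceAdd] at h0 h1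
  rw [h0, h1]
  exact ⟨N.smul_mem _ hg, N.smul_mem _ hg⟩

/-- The two shifts only give closure under polynomials in `T^2`, `T^3`; the tail inside `N` absorbs
the remainder of a power series. -/
theorem exists_seqSub_eq {N : Submodule k (ℕ → k)}
    (hs : ∀ f ∈ N, shift (2 * d) f ∈ N ∧ shift (3 * d) f ∈ N) {M : ℕ} (hM : tail k M ≤ N) :
    ∃ N' ≤ mF k d, seqSub N' = N := by
  have key (r : Cusp k) {g : ℕ → k} (hg : g ∈ N) : toSeq (r • toFree d g) ∈ N := by
    have h1 : ∑ a ∈ Finset.range (M + 3), PowerSeries.coeff a r.val • shift (a * d) g ∈ N := by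
      refine N.sum_mem fun a _ => ?_
      by_cases ha : a = 1
      · rw [ha, Cusp.coeff_one_val, zero_smul]; exact N.zero_mem
      · exact N.smul_mem _ (shift_mem hs hg a ha)
    have h2 : toSeq (r • toFree d g) -
        ∑ a ∈ Finset.range (M + 3), PowerSeries.coeff a r.val • shift (a * d) g ∈ N := by
      refine hM fun n hn => ?_
      rw [Pi.sub_apply, toSeq_smul_toFree, Finset.sum_apply, sub_eq_zero]
      refine Finset.sum_subset (Finset.range_mono ?_) fun a _ ha => ?_
      · have := Nat.div_le_self n d
        omega
      · rw [shift_apply, if_neg, mul_zero]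
        rw [← Nat.le_div_iff_mul_le (NeZero.pos d)]
        simp only [Finset.mem_range] at ha
        omega
    simpa using N.add_mem h2 h1
  refine ⟨{ carrier := {f | f ∈ mF k d ∧ toSeq f ∈ N}
            add_mem' := ?_, zero_mem' := ?_, smul_mem' := ?_ }, fun f hf => hf.1, ?_⟩
  · rintro f g ⟨hf, hf'⟩ ⟨hg, hg'⟩
    refine ⟨add_mem hf hg, ?_⟩
    have : toSeq (f + g) = toSeq f + toSeq g := by
      funext n; simp [toSeq]
    rw [this]
    exact N.add_mem hf' hg'
  · refine ⟨zero_mem _, ?_⟩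
    have : toSeq (0 : Free k d) = 0 := by funext n; simp [toSeq]
    rw [this]
    exact N.zero_mem
  · rintro r f ⟨hf, hf'⟩
    refine ⟨(mF k d).smul_mem r hf, ?_⟩
    have := key r hf'
    rwa [toFree_toSeq hf] at this
  · ext g
    rw [mem_seqSub]
    constructor
    · rintro ⟨-, h⟩
      rwa [toSeq_toFree] at h
    · intro hg
      exact ⟨toFree_mem_mF g, by rwa [toSeq_toFree]⟩

/-! ### Tails and finite codimension -/

theorem mem_freeTail {M : ℕ} {f : Free k d} :
    f ∈ freeTail k d M ↔ f ∈ mF k d ∧ toSeq f ∈ tail k (d * M) := by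
  simp only [freeTail, Submodule.mem_pi, Set.mem_univ, true_implies, mem_span_tPow_pair, mem_mF]
  constructor
  · refine fun h => ⟨fun i => h i 0 (by omega), fun n hn => h _ _ ?_⟩
    have := Nat.div_lt_of_lt_mul hn
    omega
  · rintro ⟨h0, h⟩ i m hm
    match m with
    | 0 => exact h0 i
    | 1 => exact Cusp.coeff_one_val _
    | m + 2 =>
      rw [← toSeq_apply]
      refine h _ ?_
      have : d * (m + 1) ≤ d * M := Nat.mul_le_mul_left d (by omega)
      rw [Nat.mul_succ] at this
      have := i.2
      omega

/-- Nakayama's lemma for tails. -/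
theorem tail_le_seqSub {N : Submodule (Cusp k) (Free k d)} {M : ℕ}
    (h : tail k (d * M) ≤ seqSub N ⊔ tail k (d * (M + 2))) : tail k (d * M) ≤ seqSub N := by
  have h1 : freeTail k d M ≤ N ⊔ maxIdeal k • freeTail k d M := by
    intro f hf
    obtain ⟨hfm, hft⟩ := mem_freeTail.mp hf
    obtain ⟨g, hg, t, ht, hgt⟩ := Submodule.mem_sup.mp (h hft)
    rw [← toFree_toSeq hfm, ← hgt, map_add]
    refine Submodule.add_mem_sup hg (freeTail_le_smul M (mem_freeTail.mpr ⟨toFree_mem_mF t, ?_⟩))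
    rwa [toSeq_toFree]
  have h2 : freeTail k d M ≤ N :=
    Submodule.le_of_le_smul_of_le_jacobson_bot (fg_freeTail M) maxIdeal_le_jacobson h1
  intro g hg
  exact h2 (mem_freeTail.mpr ⟨toFree_mem_mF g, by rwa [toSeq_toFree]⟩)

/-- No tail is assumed to lie in `N`: finite elimination works modulo a later tail, and Nakayama's
lemma removes the error. -/
theorem tail_le_seqSub_of_subset_orders {N : Submodule (Cusp k) (Free k d)} {M : ℕ}
    (h : Set.Ici (d * M) ⊆ orders (seqSub N)) : tail k (d * M) ≤ seqSub N := by
  refine tail_le_seqSub fun f hf => ?_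
  obtain ⟨g, hg, hgM, hfg⟩ := exists_mem_agree (seqSub N) f (d * M) hf (d * (M + 2))
  have : f - g ∈ tail k (d * (M + 2)) := fun m hm => by
    by_cases hmM : m < d * M
    · simp [hf m hmM, hgM m hmM]
    · simp [hfg m (h (not_lt.mp hmM)) hm]
  have := Submodule.add_mem_sup hg this
  rwa [add_sub_cancel] at this

/-- The quotient of `𝔪F` in terms of sequences. -/
def quotEquiv (N : Submodule (Cusp k) (Free k d)) : ((ℕ → k) ⧸ seqSub N) ≃ₗ[k] QuotMF N :=
  let φ : (ℕ → k) →ₗ[k] QuotMF N :=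
    ((N.submoduleOf (mF k d)).mkQ.restrictScalars k) ∘ₗ
      ((toFree d).codRestrict ((mF k d).restrictScalars k) toFree_mem_mF)
  have hker : seqSub N = LinearMap.ker φ := by
    ext g
    rw [mem_seqSub, LinearMap.mem_ker]
    exact (Submodule.Quotient.mk_eq_zero (N.submoduleOf (mF k d))
      (x := ⟨toFree d g, toFree_mem_mF g⟩)).symm
  have hsurj : Function.Surjective φ := by
    intro y
    obtain ⟨⟨f, hf⟩, rfl⟩ := (N.submoduleOf (mF k d)).mkQ_surjective y
    refine ⟨toSeq f, ?_⟩
    exact congrArg (N.submoduleOf (mF k d)).mkQ (Subtype.ext (toFree_toSeq hf))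
  (Submodule.quotEquivOfEq _ _ hker).trans (φ.quotKerEquivOfSurjective hsurj)

/-- The images of the tails in a finite-dimensional quotient form a descending chain. Once it is
stationary, Nakayama's lemma applies. -/
theorem exists_tail_le_of_finite {N : Submodule (Cusp k) (Free k d)}
    [Module.Finite k (QuotMF N)] : ∃ M, tail k M ≤ seqSub N := by
  have : Module.Finite k ((ℕ → k) ⧸ seqSub N) := Module.Finite.equiv (quotEquiv N).symm
  obtain ⟨M, hM⟩ := IsArtinian.monotone_stabilizes (R := k) (M := (ℕ → k) ⧸ seqSub N)
    ⟨fun M => OrderDual.toDual ((tail k (d * M)).map (seqSub N).mkQ), fun a b hab =>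
      Submodule.map_mono (tail_antitone (Nat.mul_le_mul_left d hab))⟩
  refine ⟨d * M, tail_le_seqSub ?_⟩
  have := congrArg (Submodule.comap (seqSub N).mkQ) (hM (M + 2) (by omega))
  change Submodule.comap _ (Submodule.map _ _) = Submodule.comap _ (Submodule.map _ _) at this
  rw [Submodule.comap_map_mkQ, Submodule.comap_map_mkQ] at this
  rw [← this]
  exact le_sup_right

theorem finite_and_finrank_quotMF {N : Submodule (Cusp k) (Free k d)} {M : ℕ}
    (h : tail k M ≤ seqSub N) :
    Module.Finite k (QuotMF N) ∧ Module.finrank k (QuotMF N) = (orders (seqSub N))ᶜ.ncard := by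
  obtain ⟨h1, h2⟩ := finite_and_finrank_quotient h
  exact ⟨Module.Finite.equiv (quotEquiv N), by rw [← (quotEquiv N).finrank_eq, h2]⟩

end Bridge

/-! ### Leading submodules and orders -/

section Leading

variable {k : Type*} [Field k] {d : ℕ}

theorem leadingTerm_zero : leadingTerm (0 : Free k d) = 0 := by
  funext i
  refine Cusp.val_injective (PowerSeries.ext fun m => ?_)
  rw [leadingTerm, Cusp.val_mk, PowerSeries.coeff_mk]
  simp

theorem single_eq_zero_of_not_mem {S : Set ℕ} {n : ℕ} (hn : n ∈ S) (c : k) :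
    ∀ l ∉ S, (Pi.single n c : ℕ → k) l = 0 :=
  fun _ hl => Pi.single_eq_of_ne (ne_of_mem_of_not_mem hn hl).symm _

variable [NeZero d]

/-- The order of positions is the lexicographic order of exponent and seat, that is, the monomial
order. -/
theorem le_iff_div_mod (a b : ℕ) :
    a ≤ b ↔ a / d < b / d ∨ (a / d = b / d ∧ Fin.ofNat d a ≤ Fin.ofNat d b) := by
  rw [Fin.le_def, Fin.val_ofNat, Fin.val_ofNat]
  have ha := Nat.div_add_mod a d
  have hb := Nat.div_add_mod b d
  have hd := NeZero.pos d
  have hma := Nat.mod_lt a hd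
  constructor
  · intro h
    rcases (Nat.div_le_div_right (c := d) h).lt_or_eq with hlt | heq
    · exact Or.inl hlt
    · rw [heq] at ha
      exact Or.inr ⟨heq, by omega⟩
  · rintro (h | ⟨h, h'⟩)
    · have := Nat.mul_le_mul_left d (Nat.succ_le_of_lt h)
      rw [Nat.mul_succ] at this
      omega
    · rw [h] at ha
      omega

theorem isLeadingMonomial_toFree_iff {g : ℕ → k} {m : ℕ} {i : Fin d} :
    IsLeadingMonomial (toFree d g) m i ↔ 2 ≤ m ∧ HasOrder g (d * (m - 2) + i) := by
  have hlt (l : ℕ) (j : Fin d) :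
      (m < l + 2 ∨ (m = l + 2 ∧ i ≤ j)) ↔ (2 ≤ m → d * (m - 2) + i ≤ d * l + j) := by
    by_cases hm : 2 ≤ m
    · rw [le_iff_div_mod (d := d) (d * (m - 2) + i), (mul_add_div_mod _ i).1, (mul_add_div_mod _ i).2,
        (mul_add_div_mod l j).1, (mul_add_div_mod l j).2]
      omega
    · simp only [hm, false_implies, iff_true]
      left; omega
  constructor
  · rintro ⟨h0, h⟩
    rw [coeff_toFree] at h0
    split_ifs at h0 with hm
    · refine ⟨hm, h0, fun n hn => ?_⟩
      by_contra hne
      have hcoeff := coeff_add_two_toFree g (Fin.ofNat d n) (n / d)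
      rw [Fin.val_ofNat, Nat.div_add_mod] at hcoeff
      have := (hlt _ _).mp (h _ _ (hcoeff.symm ▸ hne)) hm
      rw [Fin.val_ofNat, Nat.div_add_mod] at this
      omega
    · exact absurd rfl h0
  · rintro ⟨hm, h0, h⟩
    refine ⟨by rwa [coeff_toFree, if_pos hm], fun l j hlj => ?_⟩
    rw [coeff_toFree] at hlj
    split_ifs at hlj with hl
    · obtain ⟨l, rfl⟩ : ∃ l', l = l' + 2 := ⟨l - 2, by omega⟩
      rw [Nat.add_sub_cancel] at hlj
      refine (hlt l j).mpr fun _ => ?_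
      by_contra hlt'
      exact hlj (h _ (not_le.mp hlt'))
    · exact absurd rfl hlj

theorem HasOrder.eq {g : ℕ → k} {m n : ℕ} (hm : HasOrder g m) (hn : HasOrder g n) : m = n := by
  rcases lt_trichotomy m n with h | h | h
  · exact absurd (hn.2 m h) hm.1
  · exact h
  · exact absurd (hm.2 n h) hn.1

theorem leadingTerm_toFree {g : ℕ → k} {n : ℕ} (hg : HasOrder g n) :
    leadingTerm (toFree d g) = toFree d (Pi.single n (g n)) := by
  funext i
  refine Cusp.val_injective (PowerSeries.ext fun m => ?_)
  rw [leadingTerm, Cusp.val_mk, PowerSeries.coeff_mk, coeff_toFree, coeff_toFree,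
    isLeadingMonomial_toFree_iff]
  by_cases hm : 2 ≤ m
  · by_cases heq : d * (m - 2) + i = n
    · subst heq
      simp [hm, hg]
    · rw [if_neg fun h => heq (h.2.eq hg), if_pos hm, Pi.single_eq_of_ne heq]
  · simp [hm]

/-- The set of orders that belongs to a leading term datum. -/
def orderSet (α : Datum d) : Set ℕ := {n | n / d ∈ (α (Fin.ofNat d n)).exps}

theorem mul_add_mem_orderSet {α : Datum d} {l : ℕ} {i : Fin d} :
    d * l + i ∈ orderSet α ↔ l ∈ (α i).exps := by
  rw [orderSet, Set.mem_ofPred_eq, (mul_add_div_mod l i).1, (mul_add_div_mod l i).2]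

theorem orderSet_injective : Function.Injective (orderSet : Datum d → Set ℕ) := by
  intro α β h
  funext i
  refine MonIdeal.exps_injective (Set.ext fun l => ?_)
  rw [← mul_add_mem_orderSet, h, mul_add_mem_orderSet]

theorem toFree_mem_monSubmodule {α : Datum d} {g : ℕ → k} :
    toFree d g ∈ monSubmodule k α ↔ ∀ n ∉ orderSet α, g n = 0 := by
  simp only [monSubmodule, Submodule.mem_pi, Set.mem_univ, true_implies, mem_toIdeal,
    coeff_add_two_toFree]
  constructor
  · intro h n hn
    have := (h (Fin.ofNat d n)).2 (n / d) hn
    rwa [Fin.val_ofNat, Nat.div_add_mod] at this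
  · intro h i
    refine ⟨by rw [coeff_toFree, if_neg (by omega)], fun m hm => h _ ?_⟩
    rwa [mul_add_mem_orderSet]

theorem exists_Ici_subset_orderSet (α : Datum d) : ∃ M, Set.Ici (d * M) ⊆ orderSet α := by
  refine ⟨∑ i, ((α i).level + 2), fun n hn => ?_⟩
  have h1 : ∑ i, ((α i).level + 2) ≤ n / d := by
    rw [Nat.le_div_iff_mul_le (NeZero.pos d), mul_comm]
    exact hn
  have h2 := Finset.single_le_sum (f := fun i => (α i).level + 2) (fun _ _ => Nat.zero_le _)
    (Finset.mem_univ (Fin.ofNat d n))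
  simp only [orderSet, MonIdeal.exps, Set.mem_ofPred_eq] at h2 ⊢
  exact ⟨by omega, fun _ => by omega⟩

/-- The elements of `𝔪F` supported on a set that is closed under multiplication by `T^2`, `T^3`. -/
theorem exists_submodule_of_closed {S : Set ℕ}
    (hS : ∀ n ∈ S, n + 2 * d ∈ S ∧ n + 3 * d ∈ S) :
    ∃ N : Submodule (Cusp k) (Free k d), N ≤ mF k d ∧
      ∀ g, toFree d g ∈ N ↔ ∀ n ∉ S, g n = 0 := by
  have hcl (n) (hn : n ∈ S) (r : ℕ) (hr : r ≠ 1) : n + r * d ∈ S := by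
    induction r using Nat.strong_induction_on generalizing n with
    | _ r ih =>
      match r, hr with
      | 0, _ => simpa using hn
      | 2, _ => exact (hS n hn).1
      | 3, _ => exact (hS n hn).2
      | r + 4, _ =>
        have := ih (r + 2) (by omega) _ (hS n hn).1 (by omega)
        convert this using 1
        ring
  refine ⟨{ carrier := {f | f ∈ mF k d ∧ ∀ n ∉ S, toSeq f n = 0}
            add_mem' := ?_, zero_mem' := ?_, smul_mem' := ?_ }, fun f hf => hf.1, fun g => ?_⟩
  · rintro f g ⟨hf, hf'⟩ ⟨hg, hg'⟩
    refine ⟨add_mem hf hg, fun n hn => ?_⟩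
    have : toSeq (f + g) n = toSeq f n + toSeq g n := by simp [toSeq]
    rw [this, hf' n hn, hg' n hn, add_zero]
  · exact ⟨zero_mem _, fun n _ => by simp [toSeq]⟩
  · rintro r f ⟨hf, hf'⟩
    refine ⟨(mF k d).smul_mem r hf, fun n hn => ?_⟩
    rw [← toFree_toSeq hf, toSeq_smul_toFree]
    refine Finset.sum_eq_zero fun a _ => ?_
    by_cases ha : a = 1
    · rw [ha, Cusp.coeff_one_val, zero_mul]
    · rw [shift_apply]
      split_ifs with had
      · rw [hf' _ fun hmem => hn ?_, mul_zero]
        have := hcl _ hmem a ha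
        rwa [Nat.sub_add_cancel had] at this
      · rw [mul_zero]
  · change _ ∧ _ ↔ _
    rw [toSeq_toFree]
    exact and_iff_right (toFree_mem_mF g)

theorem orders_closed {N : Submodule (Cusp k) (Free k d)} {n : ℕ} (hn : n ∈ orders (seqSub N)) :
    n + 2 * d ∈ orders (seqSub N) ∧ n + 3 * d ∈ orders (seqSub N) := by
  obtain ⟨g, hg, hgn⟩ := hn
  exact ⟨⟨_, (shift_mem_seqSub hg).1, hgn.shift _⟩, ⟨_, (shift_mem_seqSub hg).2, hgn.shift _⟩⟩

theorem toFree_single_mem_leadingSubmodule {N : Submodule (Cusp k) (Free k d)} {n : ℕ}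
    (hn : n ∈ orders (seqSub N)) (c : k) : toFree d (Pi.single n c) ∈ leadingSubmodule N := by
  obtain ⟨g, hg, hgn⟩ := hn
  have : toFree d (Pi.single n c) = (c / g n) • leadingTerm (toFree d g) := by
    rw [leadingTerm_toFree hgn, ← map_smul, ← Pi.single_smul, smul_eq_mul,
      div_mul_cancel₀ _ hgn.1]
  rw [this, ← algebraMap_smul (Cusp k)]
  exact Submodule.smul_mem _ _ (Submodule.subset_span ⟨_, hg, rfl⟩)

theorem leadingSubmodule_le {N N' : Submodule (Cusp k) (Free k d)} (hN : N ≤ mF k d)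
    (h : ∀ n ∈ orders (seqSub N), ∀ c : k, toFree d (Pi.single n c) ∈ N') :
    leadingSubmodule N ≤ N' := by
  rw [leadingSubmodule, Submodule.span_le]
  rintro _ ⟨f, hf, rfl⟩
  have hg := toSeq_mem_seqSub hN hf
  rw [← toFree_toSeq (hN hf)]
  by_cases h0 : toSeq f = 0
  · rw [h0, map_zero, leadingTerm_zero]
    exact N'.zero_mem
  · obtain ⟨t, ht⟩ := Function.ne_iff.mp h0
    obtain ⟨n, -, hn⟩ := exists_hasOrder ht
    rw [leadingTerm_toFree hn]
    exact h n ⟨_, hg, hn⟩ _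

theorem tPow_single (l : ℕ) (i : Fin d) :
    (Pi.single i (tPow k l) : Free k d) = toFree d (Pi.single (d * l + i) 1) := by
  funext j
  refine Cusp.val_injective (PowerSeries.ext fun m => ?_)
  rw [coeff_toFree]
  by_cases hij : j = i
  · subst hij
    rw [Pi.single_eq_same, val_tPow, PowerSeries.coeff_X_pow]
    have hd := NeZero.pos d
    by_cases hm : m = l + 2
    · simp [hm]
    · rw [if_neg hm]
      split_ifs with h2
      · rw [Pi.single_eq_of_ne]
        intro h
        have := Nat.eq_of_mul_eq_mul_left hd (Nat.add_right_cancel h)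
        omega
      · rfl
  · rw [Pi.single_eq_of_ne hij, map_zero, map_zero]
    split_ifs
    · rw [Pi.single_eq_of_ne]
      intro h
      have h1 := (mul_add_div_mod (m - 2) j).2
      rw [h, (mul_add_div_mod l i).2] at h1
      exact hij h1.symm
    · rfl

theorem monSubmodule_le {α : Datum d} {N : Submodule (Cusp k) (Free k d)}
    (h : ∀ n ∈ orderSet α, toFree d (Pi.single n 1) ∈ N) : monSubmodule k α ≤ N := by
  have hle (i : Fin d) :
      (α i).toIdeal k ≤ N.comap (LinearMap.single (Cusp k) (fun _ => Cusp k) i) := by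
    have key (l : ℕ) (hl : l ∈ (α i).exps) :
        tPow k l ∈ N.comap (LinearMap.single (Cusp k) (fun _ => Cusp k) i) := by
      rw [Submodule.mem_comap, LinearMap.single_apply, tPow_single]
      exact h _ (mul_add_mem_orderSet.mpr hl)
    obtain ⟨c, l, hcl⟩ : ∃ c l, α i = ⟨c, l⟩ := ⟨_, _, rfl⟩
    rw [hcl] at key ⊢
    cases c
    · refine Ideal.span_le.mpr (Set.singleton_subset_iff.mpr (key l ⟨le_rfl, by simp⟩))
    · refine Ideal.span_le.mpr (Set.insert_subset_iff.mpr ⟨key l ⟨le_rfl, by simp⟩,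
        Set.singleton_subset_iff.mpr (key (l + 1) ⟨Nat.le_succ l, by simp⟩)⟩)
  intro f hf
  have : f = ∑ i, LinearMap.single (Cusp k) (fun _ => Cusp k) i (f i) := by
    simp only [LinearMap.single_apply]
    exact (Finset.univ_sum_single f).symm
  rw [this]
  exact N.sum_mem fun i _ => hle i (hf i trivial)

/-- The orders of `N` are closed under adding `2d` and `3d`, so the elements supported on them form
a submodule containing all leading terms. Hence generating a submodule by leading terms adds no new
monomial. -/
theorem leadingSubmodule_eq_iff {α : Datum d} {N : Submodule (Cusp k) (Free k d)}
    (hN : N ≤ mF k d) : leadingSubmodule N = monSubmodule k α ↔ orders (seqSub N) = orderSet α := by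
  constructor
  · intro h
    ext n
    constructor
    · intro hn
      have := toFree_single_mem_leadingSubmodule hn 1
      rw [h, toFree_mem_monSubmodule] at this
      by_contra hnα
      simpa using this n hnα
    · intro hn
      obtain ⟨N', -, hN'⟩ := exists_submodule_of_closed (k := k) (d := d)
        fun n (hn : n ∈ orders (seqSub N)) => orders_closed hn
      have hle : leadingSubmodule N ≤ N' := leadingSubmodule_le hN fun m hm c => by
        rw [hN']
        exact single_eq_zero_of_not_mem hm c
      have : toFree d (Pi.single n (1 : k)) ∈ monSubmodule k α := by
        rw [toFree_mem_monSubmodule]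
        exact single_eq_zero_of_not_mem hn 1
      rw [← h] at this
      by_contra hnN
      simpa using (hN' _).mp (hle this) n hnN
  · intro h
    refine le_antisymm (leadingSubmodule_le hN fun n hn c => ?_) (monSubmodule_le fun n hn => ?_)
    · rw [toFree_mem_monSubmodule]
      exact single_eq_zero_of_not_mem (h ▸ hn) c
    · exact toFree_single_mem_leadingSubmodule (h ▸ hn) 1

theorem exists_tail_le_of_orders_eq {α : Datum d} {N : Submodule (Cusp k) (Free k d)}
    (h : orders (seqSub N) = orderSet α) : ∃ M, tail k M ≤ seqSub N := by
  obtain ⟨M, hM⟩ := exists_Ici_subset_orderSet α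
  exact ⟨_, tail_le_seqSub_of_subset_orders (h ▸ hM)⟩

theorem bijOn_seqSub (α : Datum d) :
    Set.BijOn seqSub (Hilb k α) (stratum k d (orderSet α)) := by
  refine ⟨?_, ?_, ?_⟩
  · rintro N ⟨hN, hα⟩
    rw [leadingSubmodule_eq_iff hN] at hα
    exact ⟨fun f hf => shift_mem_seqSub hf, exists_tail_le_of_orders_eq hα, hα⟩
  · rintro N ⟨hN, -⟩ N' ⟨hN', -⟩ h
    exact eq_of_seqSub_eq hN hN' h
  · rintro N ⟨hs, ⟨M, hM⟩, hα⟩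
    obtain ⟨N', hN', rfl⟩ := exists_seqSub_eq hs hM
    exact ⟨N', ⟨hN', (leadingSubmodule_eq_iff hN').mpr hα⟩, rfl⟩

theorem ncard_hilb (α : Datum d) : (Hilb k α).ncard = (stratum k d (orderSet α)).ncard := by
  rw [← (bijOn_seqSub (k := k) α).image_eq, (bijOn_seqSub α).injOn.ncard_image]

theorem finite_hilb [Finite k] (α : Datum d) : (Hilb k α).Finite :=
  Set.Finite.of_finite_image ((finite_stratum d _).subset (bijOn_seqSub α).mapsTo.image_subset)
    (bijOn_seqSub α).injOn

theorem orders_monSubmodule (α : Datum d) :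
    orders (seqSub (monSubmodule k α)) = orderSet α := by
  ext n
  constructor
  · rintro ⟨g, hg, hgn⟩
    by_contra hn
    exact hgn.1 (toFree_mem_monSubmodule.mp hg n hn)
  · intro hn
    refine ⟨Pi.single n 1, ?_, by simp, fun m hm => Pi.single_eq_of_ne hm.ne _⟩
    rw [mem_seqSub, toFree_mem_monSubmodule]
    exact single_eq_zero_of_not_mem hn 1

theorem codim_eq (α : Datum d) : codim k α = (orderSet α)ᶜ.ncard := by
  obtain ⟨M, hM⟩ := exists_tail_le_of_orders_eq (k := k) (orders_monSubmodule α)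
  rw [codim, (finite_and_finrank_quotMF hM).2, orders_monSubmodule]

/-- On each seat the set contains its least exponent `l` and everything from `l + 2` on; whether it
contains `l + 1` decides the color. -/
theorem exists_orderSet_eq {S : Set ℕ} (hS : ∀ n ∈ S, n + 2 * d ∈ S ∧ n + 3 * d ∈ S) {M : ℕ}
    (hM : Set.Ici M ⊆ S) : ∃ α : Datum d, orderSet α = S := by
  classical
  have hex (i : Fin d) : ∃ l, d * l + i ∈ S := by
    refine ⟨M, hM ?_⟩
    have := Nat.le_mul_of_pos_left M (NeZero.pos d)
    exact Set.mem_Ici.mpr (by omega)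
  let α : Datum d := fun i =>
    ⟨if d * (Nat.find (hex i) + 1) + i ∈ S then Color.K else Color.J, Nat.find (hex i)⟩
  have hcl (i : Fin d) (l : ℕ) (r : ℕ) (hr : r ≠ 1) (h : d * l + i ∈ S) :
      d * (l + r) + i ∈ S := by
    induction r using Nat.strong_induction_on generalizing l with
    | _ r ih =>
      match r, hr with
      | 0, _ => exact h
      | 2, _ => convert (hS _ h).1 using 1; ring
      | 3, _ => convert (hS _ h).2 using 1; ring
      | r + 4, _ =>
        have := ih (r + 2) (by omega) (l + 2) (by omega) (by convert (hS _ h).1 using 1; ring)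
        convert this using 2
        ring
  refine ⟨α, Set.ext fun n => ?_⟩
  have key (i : Fin d) (l : ℕ) : l ∈ (α i).exps ↔ d * l + i ∈ S := by
    simp only [MonIdeal.exps, α, Set.mem_ofPred_eq]
    have h0 := Nat.find_spec (hex i)
    constructor
    · rintro ⟨h1, h2⟩
      by_cases hl : l = Nat.find (hex i) + 1
      · by_contra hlS
        exact h2 (if_neg (hl ▸ hlS)) hl
      · have := hcl i _ (l - Nat.find (hex i)) (by omega) h0
        rwa [Nat.add_sub_cancel' h1] at this
    · intro h
      refine ⟨Nat.find_min' _ h, fun hc hl => ?_⟩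
      rw [if_pos (hl ▸ h)] at hc
      exact absurd hc (by decide)
  have := key (Fin.ofNat d n) (n / d)
  rwa [Fin.val_ofNat, Nat.div_add_mod] at this

theorem hilbN_eq (n : ℕ) : HilbN k d n = ⋃ α ∈ {α : Datum d | codim k α = n}, Hilb k α := by
  ext N
  simp only [Set.mem_iUnion, Set.mem_ofPred_eq, exists_prop]
  constructor
  · rintro ⟨hN, hfin, hrank⟩
    obtain ⟨M, hM⟩ := exists_tail_le_of_finite (N := N)
    obtain ⟨α, hα⟩ := exists_orderSet_eq (d := d) (fun n hn => orders_closed hn)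
      (Ici_subset_orders hM)
    refine ⟨α, ?_, hN, (leadingSubmodule_eq_iff hN).mpr hα.symm⟩
    rw [codim_eq, hα, ← (finite_and_finrank_quotMF hM).2, hrank]
  · rintro ⟨α, hα, hN, hNα⟩
    rw [leadingSubmodule_eq_iff hN] at hNα
    obtain ⟨M, hM⟩ := exists_tail_le_of_orders_eq hNα
    obtain ⟨h1, h2⟩ := finite_and_finrank_quotMF hM
    exact ⟨hN, h1, by rw [h2, hNα, ← codim_eq (k := k), hα]⟩

theorem hilb_disjoint {α β : Datum d} (h : α ≠ β) : Disjoint (Hilb k α) (Hilb k β) := by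
  rw [Set.disjoint_left]
  rintro N ⟨hN, hα⟩ ⟨-, hβ⟩
  rw [leadingSubmodule_eq_iff hN] at hα hβ
  exact h (orderSet_injective (hα.symm.trans hβ))

end Leading

/-! ### Sorted keys and spiral raising -/

section Keys

variable {d : ℕ}

/-- The position `d * l + i` of the component of rank `h`, where `i` is its seat and `l` its
level. -/
def rankKey (x : Fin d → ℕ) (h : Fin d) : ℕ := d * x (seat x h) + seat x h

theorem seat_injective (x : Fin d → ℕ) : Function.Injective (seat x) := (Tuple.sort x).injective

theorem exists_seat_eq (x : Fin d → ℕ) (i : Fin d) : ∃ h, seat x h = i :=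
  (Tuple.sort x).surjective i

theorem rankKey_mod (x : Fin d → ℕ) (h : Fin d) : rankKey x h % d = seat x h := by
  rw [rankKey, Nat.mul_add_mod, Nat.mod_eq_of_lt (seat x h).2]

theorem rankKey_div (x : Fin d → ℕ) (h : Fin d) : rankKey x h / d = x (seat x h) := by
  have hd : 0 < d := h.pos
  rw [rankKey, Nat.mul_add_div hd, Nat.div_eq_of_lt (seat x h).2, add_zero]

theorem eq_of_rankKey_mod_eq {x : Fin d → ℕ} {b h : Fin d}
    (hbh : rankKey x b % d = rankKey x h % d) : b = h := by
  rw [rankKey_mod, rankKey_mod] at hbh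
  exact seat_injective x (Fin.ext hbh)

theorem rankKey_strictMono (x : Fin d → ℕ) : StrictMono (rankKey x) := by
  intro b h hbh
  obtain ⟨h1, h2⟩ := Tuple.eq_sort_iff.mp (rfl : Tuple.sort x = Tuple.sort x)
  rw [rankKey, rankKey]
  rcases (h1 hbh.le).lt_or_eq with hlt | heq
  · have := Nat.mul_le_mul_left d (Nat.succ_le_of_lt hlt)
    simp only [Function.comp_apply, Nat.mul_succ] at this
    have := (seat x b).2
    simp only [seat] at *
    omega
  · have := h2 b h hbh heq
    simp only [Function.comp_apply] at heq
    simp only [seat, heq]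
    have := Fin.lt_def.mp this
    omega

theorem rankKey_injective : Function.Injective (rankKey : (Fin d → ℕ) → Fin d → ℕ) := by
  intro x y h
  have hseat (b : Fin d) : seat x b = seat y b := by
    have := rankKey_mod x b
    rw [h, rankKey_mod] at this
    exact (Fin.ext this).symm
  funext i
  obtain ⟨b, rfl⟩ := exists_seat_eq x i
  have := rankKey_div x b
  rw [h, rankKey_div, ← hseat] at this
  exact this.symm

/-- An increasing list that contains one key of each seat must be the sorted one; so rank keys can
be recognized without computing the sorting permutation. -/
theorem eq_rankKey {y : Fin d → ℕ} {e : Fin d → ℕ} (he : StrictMono e)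
    (hinj : ∀ b h, e b % d = e h % d → b = h) (hy : ∀ h, ∃ i, e h = d * y i + i) :
    e = rankKey y := by
  choose τ hτ using hy
  have hτinj : Function.Injective τ := fun b h hbh => hinj b h (by
    rw [hτ b, hτ h, hbh])
  have hsort : Equiv.ofBijective τ (Finite.injective_iff_bijective.mp hτinj) = Tuple.sort y := by
    rw [Tuple.eq_sort_iff]
    constructor
    · intro b h hbh
      have := he.monotone hbh
      rw [hτ b, hτ h] at this
      simp only [Function.comp_apply, Equiv.ofBijective_apply]
      by_contra hlt
      have := Nat.mul_le_mul_left d (Nat.succ_le_of_lt (not_le.mp hlt))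
      rw [Nat.mul_succ] at this
      have := (τ h).2
      omega
    · intro b h hbh heq
      simp only [Equiv.ofBijective_apply] at heq ⊢
      have := he hbh
      rw [hτ b, hτ h, heq] at this
      exact Fin.lt_def.mpr (by omega)
  funext h
  have : seat y h = τ h := by rw [seat, ← hsort, Equiv.ofBijective_apply]
  rw [hτ, rankKey, this]

/-- The positions in the residue classes of the components of rank less than `j`. -/
def blocked (x : Fin d → ℕ) (j : Fin d) (n : ℕ) : Prop := ∃ b < j, n % d = rankKey x b % d

theorem blocked_rankKey {x : Fin d → ℕ} {j h : Fin d} : blocked x j (rankKey x h) ↔ h < j := by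
  constructor
  · rintro ⟨b, hb, heq⟩
    rwa [eq_of_rankKey_mod_eq heq]
  · exact fun h' => ⟨h, h', rfl⟩

theorem blocked_mono {x : Fin d → ℕ} {i j : Fin d} (hij : i ≤ j) {n : ℕ} (h : blocked x i n) :
    blocked x j n := by
  obtain ⟨b, hb, heq⟩ := h
  exact ⟨b, hb.trans_le hij, heq⟩

theorem isPattern_blocked (x : Fin d → ℕ) (j : Fin d) : IsPattern d (blocked x j) where
  periodic n := by simp only [blocked, Nat.add_mod_right]
  exists_free := ⟨rankKey x j, fun h => lt_irrefl j (blocked_rankKey.mp h)⟩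

theorem mem_availableSeats {x : Fin d → ℕ} {j : Fin d} {i : Fin d} :
    i ∈ availableSeats j x ↔ ¬ blocked x j i := by
  obtain ⟨h, rfl⟩ := exists_seat_eq x i
  have h1 : seat x h ∈ availableSeats j x ↔ j ≤ h := by
    simp [availableSeats, (seat_injective x).eq_iff]
  have h2 : blocked x j (seat x h) ↔ blocked x j (rankKey x h) := by
    simp only [blocked, rankKey_mod, Nat.mod_eq_of_lt (seat x h).2]
  rw [h1, h2, blocked_rankKey, not_lt]

/-- The blocked keys are the first ones and stay, while the free keys move to the right in order.
Ranks are thus preserved, which fits with keeping the color vector. -/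
theorem slide_strictMono_rankKey [NeZero d] (x : Fin d → ℕ) (j : Fin d) :
    StrictMono fun h => slide (blocked x j) (rankKey x h) := by
  have hP := isPattern_blocked x j
  intro b h hbh
  have hlt := rankKey_strictMono x hbh
  simp only
  by_cases hh : h < j
  · rw [slide_of_mem (blocked_rankKey.mpr hh), slide_of_mem (blocked_rankKey.mpr (hbh.trans hh))]
    exact hlt
  · have hfree : ¬ blocked x j (rankKey x h) := fun h' => hh (blocked_rankKey.mp h')
    rw [slide_of_free hfree]
    by_cases hb : blocked x j (rankKey x b)
    · rw [slide_of_mem hb]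
      exact hlt.trans (hP.lt_nextFree _)
    · rw [slide_of_free hb]
      exact hP.nextFree_lt hlt hfree

theorem IsPattern.mod_eq_of_slide_mod_eq [NeZero d] {P : ℕ → Prop} (h : IsPattern d P) {m n : ℕ}
    (hmn : slide P m % d = slide P n % d) : m % d = n % d := by
  wlog hle : slide P m ≤ slide P n generalizing m n
  · exact (this hmn.symm (not_le.mp hle).le).symm
  have hdvd := (Nat.modEq_iff_dvd' hle).mp hmn
  obtain ⟨r, hr⟩ := hdvd
  have : slide P (m + r * d) = slide P n := by
    rw [h.slide_add_mul, mul_comm]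
    omega
  rw [← h.slide_injective this, Nat.add_mul_mod_self_right]

theorem IsPattern.slide_mod_eq [NeZero d] {P : ℕ → Prop} (h : IsPattern d P) {m n : ℕ}
    (hmn : m % d = n % d) : slide P m % d = slide P n % d := by
  rw [← Nat.mod_add_div m d, ← Nat.mod_add_div n d, hmn, mul_comm d, mul_comm d,
    h.slide_add_mul, h.slide_add_mul, Nat.add_mul_mod_self_right, Nat.add_mul_mod_self_right]

theorem mul_add_lt_iff {l l' : ℕ} {i i' : Fin d} :
    d * l + i < d * l' + i' ↔ l < l' ∨ l = l' ∧ (i : ℕ) < i' := by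
  have := i.2
  have := i'.2
  rcases lt_trichotomy l l' with h | rfl | h
  · have := Nat.mul_le_mul_left d (Nat.succ_le_of_lt h)
    rw [Nat.mul_succ] at this
    omega
  · omega
  · have := Nat.mul_le_mul_left d (Nat.succ_le_of_lt h)
    rw [Nat.mul_succ] at this
    omega

/-- From an available seat the next free position is the next available seat on the same level or,
after the last one, the first available seat one level up. -/
theorem exists_slide_rankKey_eq [NeZero d] (x : Fin d → ℕ) (j h : Fin d) :
    ∃ i, slide (blocked x j) (rankKey x h) = d * spiral j x i + i := by
  have hP := isPattern_blocked x j
  by_cases hh : h < j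
  · have hb : blocked x j (rankKey x h) := blocked_rankKey.mpr hh
    refine ⟨seat x h, ?_⟩
    have : seat x h ∉ availableSeats j x := by
      rw [mem_availableSeats, not_not, ← hP.mod_iff, Nat.mod_eq_of_lt (seat x h).2,
        ← rankKey_mod, hP.mod_iff]
      exact hb
    rw [slide_of_mem hb, spiral, if_neg this, rankKey]
  · have hfree : ¬ blocked x j (rankKey x h) := fun h' => hh (blocked_rankKey.mp h')
    rw [slide_of_free hfree]
    obtain ⟨s, hs⟩ : ∃ s, seat x h = s := ⟨_, rfl⟩
    have hsA : s ∈ availableSeats j x := by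
      rw [mem_availableSeats, ← hs, ← rankKey_mod, hP.mod_iff]
      exact hfree
    have hfreeA (l : ℕ) (i : Fin d) : ¬ blocked x j (d * l + i) ↔ i ∈ availableSeats j x := by
      rw [mem_availableSeats, ← hP.mod_iff, Nat.mul_add_mod, hP.mod_iff]
    have hdecomp (m : ℕ) : ∃ l, ∃ i : Fin d, m = d * l + i :=
      ⟨m / d, Fin.ofNat d m, by rw [Fin.val_ofNat, Nat.div_add_mod]⟩
    rw [rankKey, hs]
    by_cases hex : ((availableSeats j x).filter (s < ·)).Nonempty
    · obtain ⟨a, ha, hmin⟩ := ((availableSeats j x).filter (s < ·)).exists_min_image id hex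
      simp only [Finset.mem_filter, id] at ha hmin
      refine ⟨a, ?_⟩
      have hspiral : spiral j x a = x s := by
        have hne : ((availableSeats j x).filter (· < a)).Nonempty :=
          ⟨s, Finset.mem_filter.mpr ⟨hsA, ha.2⟩⟩
        rw [spiral, if_pos ha.1, dif_pos hne]
        congr 1
        refine le_antisymm (Finset.max'_le _ _ _ fun i hi => ?_)
          (Finset.le_max' _ _ (Finset.mem_filter.mpr ⟨hsA, ha.2⟩))
        rw [Finset.mem_filter] at hi
        by_contra hlt
        exact absurd (hmin i ⟨hi.1, not_le.mp hlt⟩) (not_le.mpr hi.2)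
      rw [hspiral]
      refine hP.nextFree_eq (by have := Fin.lt_def.mp ha.2; omega) ((hfreeA _ _).mpr ha.1)
        fun m hm hm' => ?_
      by_contra hfm
      obtain ⟨l, i, rfl⟩ := hdecomp m
      rw [hfreeA] at hfm
      rw [mul_add_lt_iff] at hm hm'
      have hsi : s < i := by omega
      exact absurd (hmin i ⟨hfm, hsi⟩) (by omega)
    · have hle (i) (hi : i ∈ availableSeats j x) : i ≤ s := by
        by_contra hlt
        exact hex ⟨i, Finset.mem_filter.mpr ⟨hi, not_le.mp hlt⟩⟩
      obtain ⟨a, ha, hmin⟩ := (availableSeats j x).exists_min_image id ⟨s, hsA⟩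
      simp only [id] at hmin
      refine ⟨a, ?_⟩
      have hspiral : spiral j x a = x s + 1 := by
        have hne : ¬ ((availableSeats j x).filter (· < a)).Nonempty := by
          rintro ⟨i, hi⟩
          rw [Finset.mem_filter] at hi
          exact absurd (hmin i hi.1) (not_le.mpr hi.2)
        rw [spiral, if_pos ha, dif_neg hne]
        congr 2
        exact le_antisymm (Finset.max'_le _ _ _ hle) (Finset.le_max' _ _ hsA)
      rw [hspiral]
      refine hP.nextFree_eq (mul_add_lt_iff.mpr (Or.inl (Nat.lt_succ_self _)))
        ((hfreeA _ _).mpr ha) fun m hm hm' => ?_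
      by_contra hfm
      obtain ⟨l, i, rfl⟩ := hdecomp m
      rw [hfreeA] at hfm
      rw [mul_add_lt_iff] at hm hm'
      have := hmin i hfm
      have := hle i hfm
      omega

theorem rankKey_spiral [NeZero d] (x : Fin d → ℕ) (j h : Fin d) :
    rankKey (spiral j x) h = slide (blocked x j) (rankKey x h) := by
  have hP := isPattern_blocked x j
  have := eq_rankKey (slide_strictMono_rankKey x j)
    (fun b h hbh => eq_of_rankKey_mod_eq (hP.mod_eq_of_slide_mod_eq hbh))
    (exists_slide_rankKey_eq x j)
  exact (congrFun this h).symm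

/-! ### The action on leading term data -/

theorem levelVec_gamma (j : Fin d) (α : Datum d) :
    levelVec (gamma j α) = spiral j (levelVec α) :=
  congrArg Prod.fst ((levelColorEquiv d).apply_symm_apply (spiral j (levelVec α), colorVec α))

theorem colorVec_gamma (j : Fin d) (α : Datum d) : colorVec (gamma j α) = colorVec α :=
  congrArg Prod.snd ((levelColorEquiv d).apply_symm_apply (spiral j (levelVec α), colorVec α))

theorem levelVec_zeroDatum (c : Fin d → Color) : levelVec (zeroDatum c) = 0 :=
  congrArg Prod.fst ((levelColorEquiv d).apply_symm_apply (0, c))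

theorem colorVec_zeroDatum (c : Fin d → Color) : colorVec (zeroDatum c) = c :=
  congrArg Prod.snd ((levelColorEquiv d).apply_symm_apply (0, c))

theorem colorVec_act (a : Fin d → ℕ) (α : Datum d) : colorVec (act a α) = colorVec α := by
  have hiter (j : Fin d) (n : ℕ) (β : Datum d) : colorVec ((gamma j)^[n] β) = colorVec β := by
    induction n with
    | zero => rfl
    | succ n ih => rw [Function.iterate_succ_apply', colorVec_gamma, ih]
  rw [act]
  induction List.finRange d with
  | nil => rfl
  | cons j l ih => rw [List.foldr_cons, Function.comp_apply, hiter, ih]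

/-- A quantity that each `γ_(j)` raises by `w j`. -/
theorem apply_act {M : Type*} [AddCommMonoid M] {φ : Datum d → M} {w : Fin d → M}
    (hφ : ∀ j α, φ (gamma j α) = φ α + w j) (a : Fin d → ℕ) (α : Datum d) :
    φ (act a α) = φ α + ∑ j, a j • w j := by
  have hiter (j : Fin d) (n : ℕ) (β : Datum d) : φ ((gamma j)^[n] β) = φ β + n • w j := by
    induction n with
    | zero => simp
    | succ n ih => rw [Function.iterate_succ_apply', hφ, ih, succ_nsmul, add_assoc]
  rw [act, Fin.sum_univ_def]
  induction List.finRange d with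
  | nil => simp
  | cons j l ih =>
    rw [List.foldr_cons, Function.comp_apply, hiter, ih, List.map_cons, List.sum_cons]
    abel

/-! ### Coordinates of level vectors -/

open Classical in
/-- The number of positions before the component of rank `j` that are beyond the components of
lower rank and outside their residue classes. -/
def coord (x : Fin d → ℕ) (j : Fin d) : ℕ :=
  ((Finset.range (rankKey x j)).filter
    fun n => ¬ blocked x j n ∧ ∀ b < j, rankKey x b < n).card

/-- Recursion on the rank: once the lower keys are known, the coordinate is strictly increasing in
the key of rank `j`. -/
theorem coord_injective : Function.Injective (coord : (Fin d → ℕ) → Fin d → ℕ) := by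
  classical
  intro x y hxy
  refine rankKey_injective (funext fun j => ?_)
  induction j using WellFoundedLT.induction with
  | _ j ih =>
    have key {x y : Fin d → ℕ} (ih : ∀ b < j, rankKey x b = rankKey y b)
        (hlt : rankKey x j < rankKey y j) : coord x j < coord y j := by
      have hblocked (n : ℕ) : blocked x j n ↔ blocked y j n :=
        exists_congr fun b => and_congr_right fun hb => by rw [ih b hb]
      have hforall (n : ℕ) : (∀ b < j, rankKey x b < n) ↔ ∀ b < j, rankKey y b < n :=
        forall₂_congr fun b hb => by rw [ih b hb]
      rw [coord, coord]
      refine Finset.card_lt_card (Finset.ssubset_iff_of_subset (fun n hn => ?_) |>.mpr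
        ⟨rankKey x j, ?_, by simp⟩)
      · rw [Finset.mem_filter, Finset.mem_range, hblocked, hforall] at hn
        rw [Finset.mem_filter, Finset.mem_range]
        exact ⟨hn.1.trans hlt, hn.2⟩
      · rw [Finset.mem_filter, Finset.mem_range, ← hblocked, ← hforall, blocked_rankKey]
        exact ⟨hlt, lt_irrefl j, fun b hb => rankKey_strictMono x hb⟩
    rcases lt_trichotomy (rankKey x j) (rankKey y j) with h | h | h
    · exact absurd (congrFun hxy j) (key ih h).ne
    · exact h
    · exact absurd (congrFun hxy j) (key (fun b hb => (ih b hb).symm) h).ne'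

/-- Below rank `i` nothing moves. At rank `i` the key passes to the next free position, so exactly
its old position is newly counted. Above rank `i` the slide is a bijection between the counted
positions. -/
theorem coord_spiral [NeZero d] (x : Fin d → ℕ) (i : Fin d) :
    coord (spiral i x) = coord x + Pi.single i 1 := by
  classical
  have hP := isPattern_blocked x i
  have hkey_lt {b : Fin d} (hb : b < i) : rankKey (spiral i x) b = rankKey x b := by
    rw [rankKey_spiral, slide_of_mem (blocked_rankKey.mpr hb)]
  have hfree {b : Fin d} (hb : i ≤ b) : ¬ blocked x i (rankKey x b) :=
    fun h => absurd (blocked_rankKey.mp h) (not_lt.mpr hb)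
  have hkey_ge {b : Fin d} (hb : i ≤ b) :
      rankKey (spiral i x) b = nextFree (blocked x i) (rankKey x b) := by
    rw [rankKey_spiral, slide_of_free (hfree hb)]
  have hblocked {j : Fin d} (hj : j ≤ i) (n : ℕ) : blocked (spiral i x) j n ↔ blocked x j n := by
    refine exists_congr fun b => and_congr_right fun hb => ?_
    rw [hkey_lt (hb.trans_le hj)]
  have hforall {j : Fin d} (hj : j ≤ i) (n : ℕ) :
      (∀ b < j, rankKey (spiral i x) b < n) ↔ ∀ b < j, rankKey x b < n :=
    forall₂_congr fun b hb => by rw [hkey_lt (hb.trans_le hj)]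
  funext j
  rw [Pi.add_apply]
  rcases lt_trichotomy j i with hji | rfl | hij
  · rw [Pi.single_eq_of_ne hji.ne, add_zero, coord, coord, hkey_lt hji]
    simp only [hblocked hji.le, hforall hji.le]
  · rw [Pi.single_eq_same, coord, coord, hkey_ge le_rfl]
    simp only [hblocked le_rfl, hforall le_rfl]
    rw [← Finset.card_insert_of_notMem (a := rankKey x j) (by simp)]
    congr 1
    ext n
    simp only [Finset.mem_filter, Finset.mem_range, Finset.mem_insert]
    constructor
    · rintro ⟨hn, hbn, hlt⟩
      rcases lt_trichotomy n (rankKey x j) with h | h | h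
      · exact Or.inr ⟨h, hbn, hlt⟩
      · exact Or.inl h
      · exact absurd (of_lt_nextFree h hn) hbn
    · rintro (rfl | ⟨hn, hbn, hlt⟩)
      · exact ⟨hP.lt_nextFree _, hfree le_rfl, fun b hb => rankKey_strictMono x hb⟩
      · exact ⟨hn.trans (hP.lt_nextFree _), hbn, hlt⟩
  · rw [Pi.single_eq_of_ne hij.ne', add_zero, coord, coord, hkey_ge hij.le]
    have hnf {n : ℕ} (hn : ¬ blocked x j n) : ¬ blocked x i n := fun h => hn (blocked_mono hij.le h)
    symm
    refine Finset.card_bij (fun n _ => nextFree (blocked x i) n) ?_ ?_ ?_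
    · intro n hn
      simp only [Finset.mem_filter, Finset.mem_range] at hn ⊢
      obtain ⟨hn, hbn, hlt⟩ := hn
      refine ⟨hP.nextFree_lt hn (hfree hij.le), ?_, fun b hb => ?_⟩
      · rintro ⟨b, hb, heq⟩
        rw [rankKey_spiral, ← slide_of_free (hnf hbn)] at heq
        exact hbn ⟨b, hb, hP.mod_eq_of_slide_mod_eq heq⟩
      · rcases lt_or_ge b i with hbi | hbi
        · rw [hkey_lt hbi]
          exact (hlt b hb).trans (hP.lt_nextFree n)
        · rw [hkey_ge hbi]
          exact hP.nextFree_lt (hlt b hb) (hnf hbn)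
    · intro m hm n hn hmn
      simp only [Finset.mem_filter] at hm hn
      rw [← slide_of_free (hnf hm.2.1), ← slide_of_free (hnf hn.2.1)] at hmn
      exact hP.slide_injective hmn
    · intro m hm
      simp only [Finset.mem_filter, Finset.mem_range] at hm ⊢
      obtain ⟨hm, hbm, hlt⟩ := hm
      have hmi := hlt i hij
      rw [hkey_ge le_rfl] at hmi
      have hmfree : ¬ blocked x i m := by
        rintro ⟨b, hb, heq⟩
        exact hbm ⟨b, hb.trans hij, by rw [hkey_lt hb]; exact heq⟩
      -- A counted position lies beyond the slid key of rank `i`, so it is not the missed first free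
      -- position.
      obtain ⟨n, rfl⟩ : m ∈ Set.range (slide (blocked x i)) := by
        by_contra hr
        exact hfree le_rfl ((hP.not_mem_range_slide_iff.mp hr).2 _ ((hP.lt_nextFree _).trans hmi))
      rw [hP.slide_mem_iff] at hmfree
      rw [slide_of_free hmfree] at hm hlt hmi
      have hlt_of {b : Fin d} (hb : i ≤ b) (h : nextFree (blocked x i) (rankKey x b) <
          nextFree (blocked x i) n) : rankKey x b < n := by
        by_contra hle
        rcases (not_lt.mp hle).lt_or_eq with h' | h'
        · exact absurd (hP.nextFree_lt h' (hfree hb)) (not_lt.mpr h.le)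
        · rw [h'] at h
          exact lt_irrefl _ h
      have hin := hlt_of le_rfl hmi
      refine ⟨n, ⟨?_, ?_, fun b hb => ?_⟩, (slide_of_free hmfree).symm⟩
      · by_contra hle
        rcases (not_lt.mp hle).lt_or_eq with h' | h'
        · exact absurd (hP.nextFree_lt h' hmfree) (not_lt.mpr hm.le)
        · rw [h'] at hm
          exact lt_irrefl _ hm
      · rintro ⟨b, hb, heq⟩
        rcases lt_or_ge b i with hbi | hbi
        · exact hmfree ⟨b, hbi, heq⟩
        · refine hbm ⟨b, hb, ?_⟩
          rw [rankKey_spiral]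
          exact hP.slide_mod_eq heq
      · rcases lt_or_ge b i with hbi | hbi
        · exact (rankKey_strictMono x hbi).trans hin
        · have := hlt b hb
          rw [hkey_ge hbi] at this
          exact hlt_of hbi this

theorem rankKey_zero (h : Fin d) : rankKey (0 : Fin d → ℕ) h = h := by
  have := eq_rankKey (y := (0 : Fin d → ℕ)) (e := fun h => (h : ℕ)) (fun _ _ h => h)
    (fun b h hbh => by
      simp only [Nat.mod_eq_of_lt b.2, Nat.mod_eq_of_lt h.2] at hbh
      exact Fin.ext hbh) (fun h => ⟨h, by simp⟩)
  exact (congrFun this h).symm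

theorem coord_zero : coord (0 : Fin d → ℕ) = 0 := by
  classical
  funext j
  rw [coord, Pi.zero_apply, Finset.card_eq_zero, Finset.filter_eq_empty_iff]
  rintro n hn ⟨-, h⟩
  rw [Finset.mem_range, rankKey_zero] at hn
  have := h ⟨n, hn.trans j.2⟩ hn
  rw [rankKey_zero] at this
  exact lt_irrefl _ this

/-- The distance of a component with large coordinate to the components of lower rank. -/
theorem rankKey_add_lt {x : Fin d → ℕ} {j : Fin d} (hj : 3 * (d - j) ≤ coord x j) {b : Fin d}
    (hb : b < j) : rankKey x b + 3 * d < rankKey x j := by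
  classical
  by_contra hle
  rw [not_lt] at hle
  have hd : 0 < d := b.pos
  -- Pigeonhole: were the gap at most `3 * d`, the counted positions together with `rankKey x j`
  -- itself would inject into `d - j` free classes times `3` periods, which is one place too few.
  have hcard : (insert (rankKey x j) ((Finset.range (rankKey x j)).filter
      fun n => ¬ blocked x j n ∧ ∀ b < j, rankKey x b < n)).card = coord x j + 1 :=
    Finset.card_insert_of_notMem (by simp)
  have hle' := Finset.card_le_card_of_injOn
    (t := ((Finset.Ici j).image fun h => (seat x h : ℕ)) ×ˢ Finset.range 3)
    (fun n => (n % d, (n - rankKey x b - 1) / d)) (s := insert (rankKey x j)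
      ((Finset.range (rankKey x j)).filter fun n => ¬ blocked x j n ∧ ∀ b < j, rankKey x b < n))
    ?_ ?_
  · rw [hcard, Finset.card_product, Finset.card_range,
      Finset.card_image_of_injective _ (fun _ _ h => seat_injective x (Fin.ext h)),
      Fin.card_Ici] at hle'
    omega
  · intro n hn
    have hn' : ¬ blocked x j n ∧ rankKey x b < n ∧ n ≤ rankKey x j := by
      simp only [Finset.coe_insert, Finset.coe_filter, Finset.mem_range, Set.mem_insert_iff,
        Set.mem_ofPred_eq] at hn
      rcases hn with rfl | ⟨h1, h2, h3⟩
      · exact ⟨fun h => lt_irrefl j (blocked_rankKey.mp h), rankKey_strictMono x hb, le_rfl⟩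
      · exact ⟨h2, h3 b hb, h1.le⟩
    simp only [Finset.coe_product, Set.mem_prod, Finset.mem_coe, Finset.mem_image, Finset.mem_Ici,
      Finset.mem_range]
    constructor
    · obtain ⟨h, hh⟩ := exists_seat_eq x ⟨n % d, Nat.mod_lt n hd⟩
      refine ⟨h, ?_, by rw [hh]⟩
      by_contra hjh
      exact hn'.1 ⟨h, not_le.mp hjh, by rw [rankKey_mod, hh]⟩
    · rw [Nat.div_lt_iff_lt_mul hd]
      omega
  · intro m hm n hn hmn
    have hlt {n : ℕ} (hn : n ∈ insert (rankKey x j) ((Finset.range (rankKey x j)).filter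
        fun n => ¬ blocked x j n ∧ ∀ b < j, rankKey x b < n)) :
        n = rankKey x b + 1 + (n - rankKey x b - 1) := by
      have : rankKey x b < n := by
        simp only [Finset.mem_insert, Finset.mem_filter] at hn
        rcases hn with rfl | ⟨-, -, h⟩
        · exact rankKey_strictMono x hb
        · exact h b hb
      omega
    simp only [Prod.mk.injEq] at hmn
    obtain ⟨h1, h2⟩ := hmn
    have hm' := hlt hm
    have hn' := hlt hn
    rw [hm', hn'] at h1
    have h3 : (m - rankKey x b - 1) % d = (n - rankKey x b - 1) % d :=
      Nat.ModEq.add_left_cancel' _ h1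
    have h4 := Nat.div_add_mod (m - rankKey x b - 1) d
    rw [h2, h3, Nat.div_add_mod] at h4
    omega

theorem three_le_dist {x : Fin d → ℕ} {b h : Fin d} (hbh : rankKey x b + 3 * d < rankKey x h) :
    3 ≤ dist x b h := by
  have hd : (0 : ℚ) < d := Nat.cast_pos.mpr b.pos
  rw [dist, Int.le_floor]
  have h1 : ((rankKey x b + 3 * d : ℕ) : ℚ) < (rankKey x h : ℕ) := Nat.cast_lt.mpr hbh
  rw [rankKey, rankKey] at h1
  push_cast at h1 ⊢
  have h2 (l i : ℚ) : l + i / d = (d * l + i) / d := by field_simp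
  rw [h2, h2, ← sub_div, le_div_iff₀ hd]
  linarith

end Keys

/-! ### Spiral raising and strata -/

section Raising

variable {d : ℕ}

theorem card_blocked (x : Fin d → ℕ) (j : Fin d) :
    Nat.card {i : Fin d // blocked x j i} = j := by
  have : {i : Fin d | blocked x j i} = seat x '' (Finset.Iio j) := by
    ext i
    simp only [blocked, Set.mem_ofPred_eq, Nat.mod_eq_of_lt i.2, rankKey_mod, Set.mem_image,
      Finset.coe_Iio, Set.mem_Iio]
    exact exists_congr fun b => and_congr_right fun _ => ⟨fun h => Fin.ext h.symm, fun h => by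
      rw [h]⟩
  have h2 := congrArg Set.ncard this
  rw [Set.ncard_image_of_injective _ (seat_injective x), Set.ncard_coe_finset, Fin.card_Iio] at h2
  rw [← h2]
  exact Nat.card_coe_set_eq _

variable [NeZero d]

theorem mem_orderSet_iff {α : Datum d} {n : ℕ} :
    n ∈ orderSet α ↔
      ∃ h r, n = rankKey (levelVec α) h + r * d ∧ (colorVec α h = Color.J → r ≠ 1) := by
  have key (l : ℕ) (h : Fin d) : d * l + seat (levelVec α) h ∈ orderSet α ↔
      levelVec α (seat (levelVec α) h) ≤ l ∧
        (colorVec α h = Color.J → l ≠ levelVec α (seat (levelVec α) h) + 1) :=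
    mul_add_mem_orderSet
  have hkey (h : Fin d) (r : ℕ) : rankKey (levelVec α) h + r * d =
      d * (levelVec α (seat (levelVec α) h) + r) + seat (levelVec α) h := by
    rw [rankKey]; ring
  constructor
  · intro hn
    obtain ⟨h, hh⟩ := exists_seat_eq (levelVec α) (Fin.ofNat d n)
    have hn' : n = d * (n / d) + seat (levelVec α) h := by
      rw [hh, Fin.val_ofNat, Nat.div_add_mod]
    rw [hn', key] at hn
    refine ⟨h, n / d - levelVec α (seat (levelVec α) h), ?_, fun hc => ?_⟩
    · rw [hkey, Nat.add_sub_cancel' hn.1]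
      exact hn'
    · have := hn.2 hc
      omega
  · rintro ⟨h, r, rfl, hr⟩
    rw [hkey, key]
    exact ⟨by omega, fun hc => by have := hr hc; omega⟩

theorem orderSet_gamma (j : Fin d) (α : Datum d) :
    orderSet (gamma j α) = slide (blocked (levelVec α) j) '' orderSet α := by
  have hP := isPattern_blocked (levelVec α) j
  ext n
  rw [mem_orderSet_iff, levelVec_gamma, colorVec_gamma]
  simp only [rankKey_spiral, ← hP.slide_add_mul]
  constructor
  · rintro ⟨h, r, rfl, hr⟩
    exact ⟨_, mem_orderSet_iff.mpr ⟨h, r, rfl, hr⟩, rfl⟩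
  · rintro ⟨m, hm, rfl⟩
    obtain ⟨h, r, rfl, hr⟩ := mem_orderSet_iff.mp hm
    exact ⟨h, r, rfl, hr⟩

theorem finite_compl_orderSet (α : Datum d) : (orderSet α)ᶜ.Finite := by
  obtain ⟨M, hM⟩ := exists_Ici_subset_orderSet α
  refine (Set.finite_Iio (d * M)).subset fun n hn => ?_
  by_contra hle
  exact hn (hM (Set.mem_Ici.mpr (not_lt.mp hle)))

/-- The gaps of the slid set are the slid gaps and the missed position. -/
theorem codim_gamma (k : Type*) [Field k] (j : Fin d) (α : Datum d) :
    codim k (gamma j α) = codim k α + 1 := by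
  have hP := isPattern_blocked (levelVec α) j
  obtain ⟨t, ht⟩ := hP.exists_compl_range_slide
  have hfin := (finite_compl_orderSet α).image (slide (blocked (levelVec α) j))
  have htr : t ∉ Set.range (slide (blocked (levelVec α) j)) := by
    rw [← Set.mem_compl_iff, ht]; exact Set.mem_singleton t
  have : (slide (blocked (levelVec α) j) '' orderSet α)ᶜ =
      insert t (slide (blocked (levelVec α) j) '' (orderSet α)ᶜ) := by
    ext n
    by_cases hn : n ∈ Set.range (slide (blocked (levelVec α) j))
    · obtain ⟨m, rfl⟩ := hn
      rw [Set.mem_compl_iff, hP.slide_injective.mem_set_image, Set.mem_insert_iff,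
        hP.slide_injective.mem_set_image, Set.mem_compl_iff,
        or_iff_right fun h : _ = t => htr ⟨m, h⟩]
    · refine iff_of_true (fun h => hn (Set.image_subset_range _ _ h)) (Or.inl ?_)
      rwa [← Set.mem_compl_iff, ht] at hn
  rw [codim_eq, codim_eq, orderSet_gamma, this, Set.ncard_insert_of_notMem
    (fun h => htr (Set.image_subset_range _ _ h)) hfin, Set.ncard_image_of_injective _
    hP.slide_injective]

/-- At level `0`, color `K` is all of `𝔪`, and color `J` is `(T^2)`, which lacks only `T^3`. -/
theorem codim_zeroDatum (k : Type*) [Field k] (c : Fin d → Color) :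
    codim k (zeroDatum c) = numJ c := by
  have hmem (l : ℕ) (i : Fin d) :
      d * l + i ∈ orderSet (zeroDatum c) ↔ (c i = Color.J → l ≠ 1) := by
    rw [mem_orderSet_iff, levelVec_zeroDatum, colorVec_zeroDatum]
    simp only [rankKey_zero]
    constructor
    · rintro ⟨h, r, heq, hr⟩
      rw [add_comm (h : ℕ), mul_comm r] at heq
      have h1 := mul_add_div_mod l i
      rw [heq, (mul_add_div_mod r h).1, (mul_add_div_mod r h).2] at h1
      rw [← h1.1, ← h1.2]
      exact hr
    · exact fun h => ⟨i, l, by ring, h⟩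
  have : (orderSet (zeroDatum c))ᶜ =
      (fun i : Fin d => d * 1 + (i : ℕ)) '' (Finset.univ.filter fun h => c h = Color.J) := by
    ext n
    have hn := hmem (n / d) (Fin.ofNat d n)
    rw [Fin.val_ofNat, Nat.div_add_mod] at hn
    rw [Set.mem_compl_iff, hn]
    constructor
    · intro h
      simp only [ne_eq, Classical.not_imp, not_not] at h
      refine ⟨Fin.ofNat d n, by simpa using h.1, ?_⟩
      simp only
      rw [← h.2, Fin.val_ofNat, Nat.div_add_mod]
    · rintro ⟨i, hi, rfl⟩ h
      rw [(mul_add_div_mod 1 i).1, (mul_add_div_mod 1 i).2] at h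
      exact h (by simpa using hi) rfl
  rw [codim_eq, this, Set.ncard_image_of_injective _ (fun _ _ h => Fin.ext (Nat.add_left_cancel h)),
    Set.ncard_coe_finset, numJ]

theorem codim_act_zeroDatum (k : Type*) [Field k] (c : Fin d → Color) (a : Fin d → ℕ) :
    codim k (act a (zeroDatum c)) = ∑ j, a j + numJ c := by
  rw [apply_act (codim_gamma k) a, codim_zeroDatum, add_comm]
  simp

theorem separated_orderSet {α : Datum d} {j : Fin d}
    (hj : ∀ b < j, rankKey (levelVec α) b + 3 * d < rankKey (levelVec α) j) :
    ∃ E, Separated d (blocked (levelVec α) j) (orderSet α) E (rankKey (levelVec α) j) := by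
  have hex (i : {i : Fin d // blocked (levelVec α) j i}) :
      ∃ b < j, (i : ℕ) = rankKey (levelVec α) b % d := by
    obtain ⟨b, hb, heq⟩ := i.2
    rw [Nat.mod_eq_of_lt i.1.2] at heq
    exact ⟨b, hb, heq⟩
  choose b hb hmod using hex
  refine ⟨fun i => rankKey (levelVec α) (b i), fun i => (hmod i).symm,
    fun i => mem_orderSet_iff.mpr ⟨b i, 0, by simp, by simp⟩, fun i => hj _ (hb i), ?_, ?_, ?_⟩
  · intro m hm hPm
    obtain ⟨h, r, rfl, -⟩ := mem_orderSet_iff.mp hm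
    have hP := isPattern_blocked (levelVec α) j
    rw [hP.periodic_mul, ← hP.mod_iff] at hPm
    refine ⟨⟨⟨_, Nat.mod_lt _ (NeZero.pos d)⟩, hPm⟩, r, ?_⟩
    rw [← eq_of_rankKey_mod_eq (hmod ⟨⟨_, Nat.mod_lt _ (NeZero.pos d)⟩, hPm⟩)]
  · intro m hm hPm
    obtain ⟨h, r, rfl, -⟩ := mem_orderSet_iff.mp hm
    rw [(isPattern_blocked (levelVec α) j).periodic_mul, blocked_rankKey, not_lt] at hPm
    exact ((rankKey_strictMono _).monotone hPm).trans (Nat.le_add_right _ _)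
  · rintro m ⟨b, hb, heq⟩ hm
    have hlt := hj b hb
    -- The margin `3 * d` excludes `r = 1`, the one gap that color `J` leaves in a class.
    obtain ⟨r, hr⟩ := (Nat.modEq_iff_dvd' (by omega : rankKey (levelVec α) b ≤ m)).mp heq.symm
    refine mem_orderSet_iff.mpr ⟨b, r, by rw [mul_comm, ← hr]; omega, fun _ h1 => ?_⟩
    rw [h1] at hr
    omega

variable {k : Type*} [Field k] [Finite k]

/-- For `j = 0` no class is blocked and separation is vacuous; otherwise the large coordinate
provides it. -/
theorem ncard_hilb_gamma {α : Datum d} {j : Fin d}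
    (hj : (j : ℕ) = 0 ∨ 3 * (d - j) ≤ coord (levelVec α) j) :
    (Hilb k (gamma j α)).ncard = Nat.card k ^ (j : ℕ) * (Hilb k α).ncard := by
  obtain ⟨E, hE⟩ := separated_orderSet (α := α) (j := j) fun b hb => by
    rcases hj with h0 | hj
    · exact absurd (Fin.lt_def.mp hb) (by omega)
    · exact rankKey_add_lt hj hb
  rw [ncard_hilb, ncard_hilb, orderSet_gamma, hE.ncard_stratum (isPattern_blocked _ _),
    card_blocked]

end Raising

/-! ### The decomposition into orbits -/

section Orbits

variable {d : ℕ}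

theorem mem_GammaB {a b : Fin d → ℕ} : a ∈ GammaB b ↔ ∀ j ∉ generators b, a j = 0 := by
  constructor
  · intro ha j hj
    induction ha using AddSubmonoid.closure_induction with
    | mem a ha =>
      obtain ⟨i, hi, rfl⟩ := ha
      exact Pi.single_eq_of_ne (ne_of_mem_of_not_mem hi hj).symm _
    | zero => rfl
    | add a a' _ _ h h' => rw [Pi.add_apply, h, h']
  · intro ha
    have : a = ∑ j, a j • (Pi.single j 1 : Fin d → ℕ) := by
      rw [← Finset.univ_sum_single a]
      exact Finset.sum_congr rfl fun j _ => by rw [← Pi.single_smul]; simp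
    rw [this]
    refine AddSubmonoid.sum_mem _ fun j _ => ?_
    by_cases hj : j ∈ generators b
    · exact AddSubmonoid.nsmul_mem _ (AddSubmonoid.subset_closure (Set.mem_image_of_mem _ hj)) _
    · rw [ha j hj, zero_smul]
      exact AddSubmonoid.zero_mem _

/-- The element `b` of the rectangle for which `a ∈ b + Γ_b`. -/
def truncate (a : Fin d → ℕ) (j : Fin d) : ℕ := if (j : ℕ) = 0 then 0 else min (a j) (3 * (d - j))

theorem mem_rectangle {b : Fin d → ℕ} :
    b ∈ rectangle d ↔ ∀ j : Fin d, ((j : ℕ) = 0 → b j = 0) ∧ b j ≤ 3 * (d - (j : ℕ)) := by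
  rw [rectangle, Fintype.mem_piFinset]
  refine forall_congr' fun j => ?_
  split_ifs with h
  · simp only [Finset.mem_singleton]
    omega
  · simp only [Finset.mem_range]
    omega

theorem truncate_mem (a : Fin d → ℕ) : truncate a ∈ rectangle d := by
  rw [mem_rectangle]
  intro j
  rw [truncate]
  split_ifs <;> omega

theorem mem_generators {b : Fin d → ℕ} {j : Fin d} :
    j ∈ generators b ↔ (j : ℕ) = 0 ∨ b j = 3 * (d - (j : ℕ)) := by
  simp [generators]

/-- A coordinate of `b` below its cap determines that of `a`; at the cap, and at index `0`, `a` may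
exceed `b` freely, and these indices are the generators. -/
theorem truncate_eq_iff {a b : Fin d → ℕ} (hb : b ∈ rectangle d) :
    truncate a = b ↔ ∃ a' ∈ GammaB b, a = b + a' := by
  rw [mem_rectangle] at hb
  constructor
  · rintro rfl
    refine ⟨a - truncate a, mem_GammaB.mpr fun j hj => ?_, funext fun j => ?_⟩
    · rw [mem_generators, truncate] at hj
      rw [Pi.sub_apply, truncate]
      split_ifs at hj ⊢ <;> omega
    · rw [Pi.add_apply, Pi.sub_apply, truncate]
      split_ifs <;> omega
  · rintro ⟨a', ha', rfl⟩
    funext j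
    have h1 := hb j
    have h2 := mem_GammaB.mp ha' j
    rw [mem_generators] at h2
    rw [truncate, Pi.add_apply]
    split_ifs with h0
    · omega
    · by_cases h3 : b j = 3 * (d - (j : ℕ))
      · omega
      · have := h2 (by omega)
        omega

theorem colorVec_act_zeroDatum (a : Fin d → ℕ) (c : Fin d → Color) :
    colorVec (act a (zeroDatum c)) = c := by
  rw [colorVec_act, colorVec_zeroDatum]

theorem datum_eq {α β : Datum d} (hc : colorVec α = colorVec β)
    (hl : coord (levelVec α) = coord (levelVec β)) : α = β :=
  (levelColorEquiv d).injective (Prod.ext (coord_injective hl) hc)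

variable [NeZero d]

theorem coord_gamma (j : Fin d) (α : Datum d) :
    coord (levelVec (gamma j α)) = coord (levelVec α) + Pi.single j 1 := by
  rw [levelVec_gamma, coord_spiral]

theorem coord_act (a : Fin d → ℕ) (α : Datum d) :
    coord (levelVec (act a α)) = coord (levelVec α) + a := by
  rw [apply_act (φ := fun α => coord (levelVec α)) coord_gamma]
  congr 1
  conv_rhs => rw [← Finset.univ_sum_single a]
  exact Finset.sum_congr rfl fun j _ => by rw [← Pi.single_smul]; simp

theorem coord_act_zeroDatum (a : Fin d → ℕ) (c : Fin d → Color) :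
    coord (levelVec (act a (zeroDatum c))) = a := by
  rw [coord_act, levelVec_zeroDatum, coord_zero, zero_add]

theorem eq_act_zeroDatum (α : Datum d) :
    α = act (coord (levelVec α)) (zeroDatum (colorVec α)) :=
  datum_eq (colorVec_act_zeroDatum _ _).symm (coord_act_zeroDatum _ _).symm

/-- Colors and coordinates determine a datum, and coordinates add; so the order in which the
operators are applied does not matter. -/
theorem act_act_zeroDatum (a b : Fin d → ℕ) (c : Fin d → Color) :
    act a (act b (zeroDatum c)) = act (b + a) (zeroDatum c) := by
  refine datum_eq ?_ ?_
  · rw [colorVec_act, colorVec_act_zeroDatum, colorVec_act_zeroDatum]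
  · rw [coord_act, coord_act_zeroDatum, coord_act_zeroDatum]

theorem gamma_act_zeroDatum (j : Fin d) (a : Fin d → ℕ) (c : Fin d → Color) :
    gamma j (act a (zeroDatum c)) = act (a + Pi.single j 1) (zeroDatum c) := by
  refine datum_eq ?_ ?_
  · rw [colorVec_gamma, colorVec_act_zeroDatum, colorVec_act_zeroDatum]
  · rw [coord_gamma, coord_act_zeroDatum, coord_act_zeroDatum]

/-- The orbits are the fibres of a map on `Ξ`; covering and disjointness are immediate from this. -/
theorem mem_orbit_iff {c : Fin d → Color} {b : Fin d → ℕ} (hb : b ∈ rectangle d) {α : Datum d} :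
    α ∈ orbit c b ↔ colorVec α = c ∧ truncate (coord (levelVec α)) = b := by
  rw [truncate_eq_iff hb]
  constructor
  · rintro ⟨a, ha, rfl⟩
    simp only
    rw [act_act_zeroDatum, colorVec_act_zeroDatum, coord_act_zeroDatum]
    exact ⟨rfl, a, ha, rfl⟩
  · rintro ⟨rfl, a, ha, h⟩
    refine ⟨a, ha, ?_⟩
    simp only
    rw [act_act_zeroDatum, ← h, ← eq_act_zeroDatum]

theorem iUnion_orbit :
    (Set.univ : Set (Datum d)) = ⋃ c : Fin d → Color, ⋃ b ∈ rectangle d, orbit c b := by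
  symm
  rw [Set.eq_univ_iff_forall]
  intro α
  simp only [Set.mem_iUnion, exists_prop]
  exact ⟨colorVec α, truncate (coord (levelVec α)), truncate_mem _,
    (mem_orbit_iff (truncate_mem _)).mpr ⟨rfl, rfl⟩⟩

theorem pairwiseDisjoint_orbit :
    {p : (Fin d → Color) × (Fin d → ℕ) | p.2 ∈ rectangle d}.PairwiseDisjoint
      fun p => orbit p.1 p.2 := by
  rintro ⟨c, b⟩ hb ⟨c', b'⟩ hb' hne
  rw [Function.onFun, Set.disjoint_left]
  intro α hα hα'
  rw [mem_orbit_iff hb] at hα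
  rw [mem_orbit_iff hb'] at hα'
  exact hne (Prod.ext (hα.1.symm.trans hα'.1) (hα.2.symm.trans hα'.2))

theorem isStable_act_zeroDatum (c : Fin d → Color) {b : Fin d → ℕ} {j : Fin d}
    (hj : j ∈ generators b) : IsStable j (act b (zeroDatum c)) := by
  intro i h hi hh
  have hlt : rankKey (levelVec (act b (zeroDatum c))) i + 3 * d <
      rankKey (levelVec (act b (zeroDatum c))) h := by
    refine (rankKey_add_lt ?_ hi).trans_le ((rankKey_strictMono _).monotone hh)
    rw [coord_act_zeroDatum]
    rcases mem_generators.mp hj with h0 | h3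
    · exact absurd (Fin.lt_def.mp hi) (by omega)
    · exact h3.ge
  have := three_le_dist hlt
  exact ⟨fun _ => by omega, fun _ _ => this⟩

/-- Raising never lowers a coordinate, so the thresholds for the generators of `Γ_b` stay satisfied
along the orbit and each step contributes its factor. -/
theorem ncard_hilb_act (k : Type*) [Field k] [Finite k] (c : Fin d → Color) {b a : Fin d → ℕ}
    (ha : a ∈ GammaB b) : (Hilb k (act (b + a) (zeroDatum c))).ncard =
      Nat.card k ^ (∑ j : Fin d, (j : ℕ) * a j) * (Hilb k (act b (zeroDatum c))).ncard := by
  obtain ⟨n, hn⟩ : ∃ n, ∑ j, a j = n := ⟨_, rfl⟩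
  induction n generalizing a with
  | zero =>
    have : a = 0 := funext fun j => (Finset.sum_eq_zero_iff.mp hn) j (Finset.mem_univ j)
    simp [this]
  | succ n ih =>
    obtain ⟨j, -, hj⟩ := Finset.exists_ne_zero_of_sum_ne_zero (hn.trans_ne (Nat.succ_ne_zero n))
    rw [mem_GammaB] at ha
    have hjG : j ∈ generators b := by
      by_contra hjG
      exact hj (ha j hjG)
    obtain ⟨a', rfl⟩ : ∃ a' : Fin d → ℕ, a = a' + Pi.single j 1 := by
      refine ⟨a - Pi.single j 1, funext fun i => ?_⟩
      simp only [Pi.add_apply, Pi.sub_apply]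
      by_cases hij : i = j
      · subst hij
        rw [Pi.single_eq_same]
        omega
      · rw [Pi.single_eq_of_ne hij]
        omega
    have ha' : a' ∈ GammaB b := mem_GammaB.mpr fun i hi =>
      (Nat.add_eq_zero_iff.mp (ha i hi)).1
    have hsum : ∑ i, a' i = n := by
      simp only [Pi.add_apply, Finset.sum_add_distrib, Finset.sum_pi_single', Finset.mem_univ,
        if_true] at hn
      omega
    rw [← add_assoc, ← gamma_act_zeroDatum, ncard_hilb_gamma, ih ha' hsum, ← mul_assoc, ← pow_add]
    · congr 2
      simp only [Pi.add_apply, mul_add, Finset.sum_add_distrib]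
      rw [Finset.sum_eq_single j (f := fun i : Fin d => (i : ℕ) * (Pi.single j 1 : Fin d → ℕ) i)]
      · rw [Pi.single_eq_same]; ring
      · intro i _ hij
        rw [Pi.single_eq_of_ne hij, mul_zero]
      · simp
    · rw [coord_act_zeroDatum]
      rcases mem_generators.mp hjG with h0 | h3
      · exact Or.inl h0
      · exact Or.inr (by rw [Pi.add_apply]; omega)

end Orbits

/-! ### The generating series -/

section Series

theorem inv_one_sub_C_mul_X (r : ℚ) :
    (1 - PowerSeries.C r * PowerSeries.X)⁻¹ = PowerSeries.mk fun n => r ^ n := by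
  rw [PowerSeries.inv_eq_iff_mul_eq_one (by simp)]
  ext n
  rw [mul_sub, mul_one, ← mul_assoc, map_sub]
  cases n with
  | zero => simp
  | succ n =>
    rw [PowerSeries.coeff_succ_mul_X, PowerSeries.coeff_mul_C, PowerSeries.coeff_mk,
      PowerSeries.coeff_mk, PowerSeries.coeff_one, if_neg (Nat.succ_ne_zero n), pow_succ, sub_self]

theorem prod_inv_one_sub {ι : Type*} (s : Finset ι) (r : ι → ℚ) :
    (∏ j ∈ s, (1 - PowerSeries.C (r j) * PowerSeries.X))⁻¹ =
      ∏ j ∈ s, PowerSeries.mk fun n => r j ^ n := by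
  rw [PowerSeries.inv_eq_iff_mul_eq_one (by simp), ← Finset.prod_mul_distrib]
  refine Finset.prod_eq_one fun j _ => ?_
  rw [← inv_one_sub_C_mul_X, PowerSeries.inv_mul_cancel _ (by simp)]

theorem coeff_prod_inv_one_sub {ι : Type*} [DecidableEq ι] (s : Finset ι) (r : ι → ℚ) (n : ℕ) :
    PowerSeries.coeff n (∏ j ∈ s, (1 - PowerSeries.C (r j) * PowerSeries.X))⁻¹ =
      ∑ l ∈ s.finsuppAntidiag n, ∏ j ∈ s, r j ^ l j := by
  rw [prod_inv_one_sub, PowerSeries.coeff_prod]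
  simp only [PowerSeries.coeff_mk]

variable {d : ℕ} [NeZero d] (k : Type*) [Field k]

theorem content_act_zeroDatum (c : Fin d → Color) (b : Fin d → ℕ) :
    content k (act b (zeroDatum c)) =
      PowerSeries.C ((Hilb k (act b (zeroDatum c))).ncard : ℚ) *
        PowerSeries.X ^ ((∑ j, b j) + numJ c) := by
  rw [content, codim_act_zeroDatum]

variable [Finite k]

/-- The strata of codimension `n` are indexed by the pairs of a color vector `c` and a vector `a`
with `∑ a_j + numJ c = n`. -/
theorem finite_hilbN_and_ncard (n : ℕ) :
    (HilbN k d n).Finite ∧ (HilbN k d n).ncard =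
      ∑ c : Fin d → Color, if numJ c ≤ n then
        ∑ a ∈ Finset.piAntidiag Finset.univ (n - numJ c), (Hilb k (act a (zeroDatum c))).ncard
      else 0 := by
  classical
  let I : Finset ((_ : Fin d → Color) × (Fin d → ℕ)) := Finset.univ.sigma fun c =>
    if numJ c ≤ n then Finset.piAntidiag Finset.univ (n - numJ c) else ∅
  let φ : ((_ : Fin d → Color) × (Fin d → ℕ)) → Datum d := fun p => act p.2 (zeroDatum p.1)
  have hφ : Function.Injective φ := by
    rintro ⟨c, a⟩ ⟨c', a'⟩ h
    have hc := congrArg colorVec h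
    have ha := congrArg (fun α => coord (levelVec α)) h
    simp only [φ, colorVec_act_zeroDatum, coord_act_zeroDatum] at hc ha
    rw [hc, ha]
  have hset : {α : Datum d | codim k α = n} = (I.image φ : Finset (Datum d)) := by
    ext α
    rw [Finset.mem_coe, Finset.mem_image, Set.mem_ofPred_eq]
    have hmem (c : Fin d → Color) (a : Fin d → ℕ) :
        (⟨c, a⟩ : (_ : Fin d → Color) × (Fin d → ℕ)) ∈ I ↔ ∑ j, a j + numJ c = n := by
      simp only [I, Finset.mem_sigma, Finset.mem_univ, true_and]
      split_ifs with h
      · simp only [Finset.mem_piAntidiag, Finset.mem_univ, implies_true, and_true]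
        change ∑ j, a j = _ ↔ _
        omega
      · simp only [Finset.notMem_empty, false_iff]
        omega
    constructor
    · intro h
      refine ⟨⟨colorVec α, coord (levelVec α)⟩, ?_, (eq_act_zeroDatum α).symm⟩
      rw [hmem, ← codim_act_zeroDatum k, ← eq_act_zeroDatum, h]
    · rintro ⟨⟨c, a⟩, h, rfl⟩
      rw [hmem] at h
      rw [codim_act_zeroDatum, h]
  have hN : HilbN k d n = ⋃ α ∈ I.image φ, Hilb k α := by
    rw [hilbN_eq, hset]
    rfl
  rw [hN]
  refine ⟨Set.Finite.biUnion (I.image φ).finite_toSet fun α _ => finite_hilb α, ?_⟩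
  have := Set.Finite.ncard_biUnion (I.image φ).finite_toSet (s := fun α => Hilb k α)
    (fun α _ => finite_hilb α) (fun α _ β _ h => hilb_disjoint h)
  simp only [Finset.mem_coe] at this
  rw [this, finsum_mem_finset_eq_sum, Finset.sum_image hφ.injOn, Finset.sum_sigma]
  refine Finset.sum_congr rfl fun c _ => ?_
  split_ifs <;> simp [φ]

/-- The exponents in the expansion of the geometric series of the generators are the elements of
`Γ_b`, and translation by `b` matches the two sums. -/
theorem sum_piAntidiag_truncate_eq (c : Fin d → Color) {b : Fin d → ℕ} (hb : b ∈ rectangle d)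
    (n : ℕ) :
    ∑ a ∈ (Finset.piAntidiag Finset.univ n).filter (fun a => truncate a = b),
        ((Hilb k (act a (zeroDatum c))).ncard : ℚ) =
      PowerSeries.coeff n ((∏ j ∈ generators b,
        (1 - PowerSeries.C ((Nat.card k : ℚ) ^ (j : ℕ)) * PowerSeries.X))⁻¹ *
      (PowerSeries.C ((Hilb k (act b (zeroDatum c))).ncard : ℚ) *
        PowerSeries.X ^ (∑ j, b j))) := by
  rw [← mul_assoc, PowerSeries.coeff_mul_X_pow', mul_comm, PowerSeries.coeff_C_mul]
  split_ifs with hbn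
  · rw [coeff_prod_inv_one_sub, Finset.mul_sum]
    have hsub (a : Fin d → ℕ) : b + a - b = a := funext fun j => Nat.add_sub_cancel_left (b j) (a j)
    have hsupp {l : Fin d →₀ ℕ} (hl : l.support ⊆ generators b) : ⇑l ∈ GammaB b :=
      mem_GammaB.mpr fun j hj => Finsupp.notMem_support_iff.mp fun h => hj (hl h)
    have hsum {a : Fin d → ℕ} (ha : a ∈ GammaB b) : ∑ j ∈ generators b, a j = ∑ j, a j :=
      Finset.sum_subset (Finset.subset_univ _) fun j _ hj => mem_GammaB.mp ha j hj
    refine Finset.sum_bij' (fun a _ => Finsupp.equivFunOnFinite.symm (a - b)) (fun l _ => b + ⇑l)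
      ?_ ?_ ?_ ?_ ?_
    · intro a ha
      rw [Finset.mem_filter, Finset.mem_piAntidiag, truncate_eq_iff hb] at ha
      obtain ⟨⟨hs, -⟩, a', ha', rfl⟩ := ha
      simp only [Pi.add_apply, Finset.sum_add_distrib] at hs
      rw [Finset.mem_finsuppAntidiag, hsub]
      simp only [Finsupp.equivFunOnFinite_symm_apply_apply, hsum ha']
      refine ⟨by omega, fun j hj => ?_⟩
      by_contra hjG
      exact Finsupp.mem_support_iff.mp hj (mem_GammaB.mp ha' j hjG)
    · intro l hl
      rw [Finset.mem_finsuppAntidiag] at hl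
      rw [Finset.mem_filter, Finset.mem_piAntidiag, truncate_eq_iff hb]
      refine ⟨⟨?_, by simp⟩, l, hsupp hl.2, rfl⟩
      simp only [Pi.add_apply, Finset.sum_add_distrib]
      rw [← hsum (hsupp hl.2)]
      exact (congrArg (_ + ·) hl.1).trans (Nat.add_sub_cancel' hbn)
    · intro a ha
      rw [Finset.mem_filter, truncate_eq_iff hb] at ha
      obtain ⟨-, a', -, rfl⟩ := ha
      rw [hsub]
      simp
    · intro l hl
      rw [hsub]
      simp
    · intro a ha
      rw [Finset.mem_filter, truncate_eq_iff hb] at ha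
      obtain ⟨-, a', ha', rfl⟩ := ha
      rw [ncard_hilb_act k c ha', hsub]
      push_cast
      rw [mul_comm]
      congr 1
      simp only [Finsupp.equivFunOnFinite_symm_apply_apply, ← pow_mul]
      rw [Finset.prod_pow_eq_pow_sum]
      congr 1
      exact (Finset.sum_subset (Finset.subset_univ _) fun j _ hj => by
        rw [mem_GammaB.mp ha' j hj, mul_zero]).symm
  · rw [Finset.sum_eq_zero]
    intro a ha
    rw [Finset.mem_filter, Finset.mem_piAntidiag, truncate_eq_iff hb] at ha
    obtain ⟨⟨hs, -⟩, a', -, rfl⟩ := ha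
    simp only [Pi.add_apply, Finset.sum_add_distrib] at hs
    omega

theorem H_eq : H k d = ∑ c : Fin d → Color, ∑ b ∈ rectangle d,
    (∏ j ∈ generators b, (1 - PowerSeries.C ((Nat.card k : ℚ) ^ (j : ℕ)) * PowerSeries.X))⁻¹ *
      (PowerSeries.C ((Hilb k (act b (zeroDatum c))).ncard : ℚ) *
        PowerSeries.X ^ ((∑ j, b j) + numJ c)) := by
  ext n
  rw [H, PowerSeries.coeff_mk, (finite_hilbN_and_ncard k n).2, map_sum, Nat.cast_sum]
  refine Finset.sum_congr rfl fun c _ => ?_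
  simp only [pow_add, ← mul_assoc]
  rw [← Finset.sum_mul, PowerSeries.coeff_mul_X_pow']
  split_ifs with h
  · rw [map_sum, Nat.cast_sum,
      -- Grouping by truncation is the orbit decomposition for a fixed color vector.
      ← Finset.sum_fiberwise_of_maps_to (g := truncate) (t := rectangle d)
        fun a _ => truncate_mem a]
    refine Finset.sum_congr rfl fun b hb => ?_
    rw [sum_piAntidiag_truncate_eq k c hb, mul_assoc]
  · rw [Nat.cast_zero]

/-- Each denominator is a subproduct of the full product, so the factors outside `generators b`
survive as an integral polynomial. -/
theorem exists_polynomial : ∃ p : Polynomial ℤ,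
    ((p.map (Int.castRingHom ℚ) : Polynomial ℚ) : PowerSeries ℚ) =
      (∏ j ∈ Finset.range d,
        (1 - PowerSeries.C ((Nat.card k : ℚ) ^ j) * PowerSeries.X)) * H k d := by
  refine ⟨∑ c : Fin d → Color, ∑ b ∈ rectangle d,
    (∏ j ∈ Finset.univ \ generators b,
      (1 - Polynomial.C ((Nat.card k : ℤ) ^ (j : ℕ)) * Polynomial.X)) *
      (Polynomial.C ((Hilb k (act b (zeroDatum c))).ncard : ℤ) *
        Polynomial.X ^ ((∑ j, b j) + numJ c)), ?_⟩
  rw [H_eq, Finset.mul_sum, ← Polynomial.coeToPowerSeries.ringHom_apply, Polynomial.map_sum, map_sum]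
  refine Finset.sum_congr rfl fun c _ => ?_
  rw [Finset.mul_sum, Polynomial.map_sum, map_sum]
  refine Finset.sum_congr rfl fun b _ => ?_
  have hne : PowerSeries.constantCoeff (∏ j ∈ generators b,
      (1 - PowerSeries.C ((Nat.card k : ℚ) ^ (j : ℕ)) * PowerSeries.X)) ≠ 0 := by simp
  rw [Finset.prod_range (fun j => 1 - PowerSeries.C ((Nat.card k : ℚ) ^ j) *
    PowerSeries.X), ← Finset.prod_sdiff (Finset.subset_univ (generators b)), mul_assoc,
    ← mul_assoc _ _ (PowerSeries.C _ * _), PowerSeries.mul_inv_cancel _ hne, one_mul]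
  have hX : Polynomial.coeToPowerSeries.ringHom (Polynomial.X : Polynomial ℚ) = PowerSeries.X :=
    Polynomial.coe_X
  simp [Polynomial.map_prod, map_prod, -Polynomial.coeToPowerSeries.ringHom_apply, hX]

end Series

end

end CuspQuot

theorem mainTheorem5 (k : Type*) [Field k] [Finite k] (d : ℕ) (hd : 1 ≤ d) :
    -- the sets to be counted are finite
    (∀ n : ℕ, (CuspQuot.HilbN k d n).Finite) ∧
    (∀ α : CuspQuot.Datum d, (CuspQuot.Hilb k α).Finite) ∧
    -- the decomposition of `Ξ` into finitely many stable orbits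
    (∀ c : Fin d → CuspQuot.Color, ∀ b ∈ CuspQuot.rectangle d, ∀ j ∈ CuspQuot.generators b,
      CuspQuot.IsStable j (CuspQuot.act b (CuspQuot.zeroDatum c))) ∧
    ((Set.univ : Set (CuspQuot.Datum d)) =
      ⋃ c : Fin d → CuspQuot.Color, ⋃ b ∈ CuspQuot.rectangle d, CuspQuot.orbit c b) ∧
    ({p : (Fin d → CuspQuot.Color) × (Fin d → ℕ) | p.2 ∈ CuspQuot.rectangle d}.PairwiseDisjoint
      fun p => CuspQuot.orbit p.1 p.2) ∧
    -- the two forms of the formula for `H_d(t)`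
    (CuspQuot.H k d = ∑ c : Fin d → CuspQuot.Color, ∑ b ∈ CuspQuot.rectangle d,
      (∏ j ∈ CuspQuot.generators b,
        (1 - PowerSeries.C ((Nat.card k : ℚ) ^ (j : ℕ)) * PowerSeries.X))⁻¹ *
      CuspQuot.content k (CuspQuot.act b (CuspQuot.zeroDatum c))) ∧
    (CuspQuot.H k d = ∑ c : Fin d → CuspQuot.Color, ∑ b ∈ CuspQuot.rectangle d,
      (∏ j ∈ CuspQuot.generators b,
        (1 - PowerSeries.C ((Nat.card k : ℚ) ^ (j : ℕ)) * PowerSeries.X))⁻¹ *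
      (PowerSeries.C ((CuspQuot.Hilb k (CuspQuot.act b (CuspQuot.zeroDatum c))).ncard : ℚ) *
        PowerSeries.X ^ ((∑ j, b j) + CuspQuot.numJ c))) ∧
    -- `(t;q)_d H_d(t)` is a polynomial
    (∃ P : Polynomial ℤ,
      ((P.map (Int.castRingHom ℚ) : Polynomial ℚ) : PowerSeries ℚ) =
        (∏ j ∈ Finset.range d,
          (1 - PowerSeries.C ((Nat.card k : ℚ) ^ j) * PowerSeries.X)) * CuspQuot.H k d) := by
  have : NeZero d := ⟨by omega⟩
  refine ⟨fun n => (CuspQuot.finite_hilbN_and_ncard k n).1, CuspQuot.finite_hilb,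
    fun c b _ j hj => CuspQuot.isStable_act_zeroDatum c hj, CuspQuot.iUnion_orbit,
    CuspQuot.pairwiseDisjoint_orbit, ?_, CuspQuot.H_eq k, CuspQuot.exists_polynomial k⟩
  simp only [CuspQuot.content_act_zeroDatum]
  exact CuspQuot.H_eq k
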